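/- **Setting.** An instance of the Lovász Local Lemma (LLL) consists of finitely many mutually independent random variables $X_1,\dots,X_m$ (each with values in some measurable space) and events $\mathcal E_1,\dots,\mathcal E_n$, where $\mathcal E_v$ is determined by the values of a finite set $\operatorname{vbl}(\mathcal E_v)$ of these variables. Its dependency graph has the events as nodes, and two distinct events are adjacent if they share a variable. No bound is imposed on the number of events that a variable may affect. In the distributed LLL, the dependency graph is the communication network of the (synchronous, deterministic) LOCAL model: in each round every node sends an arbitrarily large message to each of its neighbours and then performs an arbitrary internal computation; each node eventually terminates with an output, and the running time is the number of rounds until the last node terminates. Initially the node $\mathcal E_v$ knows $n$, a bound $d$ on the maximum degree, its own degree, its own identifier, the set $\operatorname{vbl}(\mathcal E_v)$, the distributions of these variables, and the combinations of their values for which $\mathcal E_v$ occurs. The identifiers are distinct and lie in $\{1,\dots,n^c\}$ for a fixed constant $c$. Every node has to output a value for each variable in $\operatorname{vbl}(\mathcal E_v)$ such that nodes sharing a variable output the same value for it and under the resulting assignment none of the events occurs. **Theorem.** There is a deterministic LOCAL algorithm that solves the distributed LLL in $O(d^2+\log^* n)$ rounds under the criterion $p2^d<1$. That is, for every $c$ there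 are a constant $C$ and, for every collection of variable names with associated value spaces ($C$ not depending on it), a deterministic LOCAL algorithm such that for all $n$, $d$, $p$ with $p2^d<1$ and every LLL instance with $n$ events on variables from this collection, in whose dependency graph every node has degree at most $d$ and in which every event has probability at most $p$, the algorithm terminates within $C\,(d^2+\log^* n)$ rounds with a correct output, for all identifiers in $\{1,\dots,n^c\}$ and all port numberings. Here $\log^* n$ is the least $k$ such that the $k$-fold iterated binary logarithm of $n$ is at most $1$. -/

import Mathlib

open MeasureTheory ProbabilityTheory

universe u w z

noncomputable section

/-- The iterated logarithm `log* n`: the least number of times the binary logarithm has to be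
applied, starting from `n`, until the result is at most `1`. -/
def logStar (n : ℕ) : ℕ :=
  sInf {k : ℕ | (Real.logb 2)^[k] (n : ℝ) ≤ 1}

/-! ### The LOCAL model -/

/-- A communication network on the graph `G`: pairwise distinct identifiers for the nodes, and at
every node a numbering (by "ports") of its incident edges. -/
structure LocalNetwork {V : Type*} (G : SimpleGraph V) where
  /-- the identifier of a node -/
  ident : V → ℕ
  ident_injective : Function.Injective ident
  /-- the number of neighbours of a node -/
  deg : V → ℕ
  /-- `port v j` is the neighbour of `v` at the other end of port number `j` of `v` -/
  port : ∀ v, Fin (deg v) ≃ G.neighborSet v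

/-- A deterministic algorithm in the LOCAL model, for nodes with local inputs in `In` and local
outputs in `Out`. States and messages are arbitrary objects and all maps are arbitrary functions:
message size and internal computation are unrestricted. -/
structure LocalAlgorithm (In : Type u) (Out : Type w) where
  /-- the possible states of a node -/
  State : Type u
  /-- the possible messages -/
  Msg : Type u
  /-- the initial state, as a function of the number `n` of nodes, the degree bound `d`, the node's
  identifier, the node's degree, and the node's local input -/
  start : (n d ident deg : ℕ) → In → State
  /-- the message that a node in a given state sends through the port with a given number -/
  send : State → ℕ → Msg
  /-- the new state, as a function of the old one and of the list, in the order of the ports, of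
  what arrived through them in this round (`none`: the neighbour there has terminated before) -/
  receive : State → List (Option Msg) → State
  /-- a node terminates as soon as this is `some o`, and then `o` is its output -/
  output : State → Option Out

namespace LocalAlgorithm

variable {In : Type*} {Out : Type*} {V : Type*} {G : SimpleGraph V}

/-- A node has terminated if it is in a state with an output. -/
def Terminated (A : LocalAlgorithm In Out) (s : A.State) : Prop :=
  ∃ o, A.output s = some o

open Classical in
/-- What the node `v` receives through its port `j` when the nodes are in the states `σ`. -/
def incoming (A : LocalAlgorithm In Out) (N : LocalNetwork G) (σ : V → A.State) (v : V)
    (j : Fin (N.deg v)) : Option A.Msg :=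
  let u : G.neighborSet v := N.port v j
  if A.Terminated (σ u) then none
  else some (A.send (σ u) ((N.port u).symm ⟨v, G.adj_symm u.2⟩))

open Classical in
/-- One synchronous round: all nodes that have not terminated send a message to each of their
neighbours, and then compute their new states from the messages that they have received. -/
def step (A : LocalAlgorithm In Out) (N : LocalNetwork G) (σ : V → A.State) : V → A.State :=
  fun v => if A.Terminated (σ v) then σ v
    else A.receive (σ v) (List.ofFn (A.incoming N σ v))

/-- The states of the nodes after `T` rounds, with global parameters `n` and `d` and local inputs
`inp`. -/
def run (A : LocalAlgorithm In Out) (N : LocalNetwork G) (n d : ℕ) (inp : V → In) (T : ℕ) :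
    V → A.State :=
  (A.step N)^[T] (fun v => A.start n d (N.ident v) (N.deg v) (inp v))

/-- The algorithm terminates within `T` rounds, and then the outputs of the nodes are `out`. -/
def OutputsWithin (A : LocalAlgorithm In Out) (N : LocalNetwork G) (n d : ℕ) (inp : V → In)
    (T : ℕ) (out : V → Out) : Prop :=
  ∀ v, A.output (A.run N n d inp T v) = some (out v)

end LocalAlgorithm

/-! ### The distributed Lovász Local Lemma -/

/-- An instance of the Lovász Local Lemma with `n` events. The variables are named by elements of
`ι`, and `Val i` is the space in which a variable with the name `i` takes its values. -/
structure LLLInstance {ι : Type u} (Val : ι → Type w) [∀ i, MeasurableSpace (Val i)]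
    (n : ℕ) where
  /-- the probability space -/
  Ω : Type z
  [mΩ : MeasurableSpace Ω]
  /-- the probability measure -/
  P : Measure Ω
  [isProb : IsProbabilityMeasure P]
  /-- the finite set of (the names of) the random variables -/
  vars : Finset ι
  /-- the random variables -/
  X : (i : vars) → Ω → Val i
  measurable_X : ∀ i, Measurable (X i)
  indep : iIndepFun X P
  /-- the variables that an event depends on -/
  vbl : Fin n → Finset ι
  vbl_subset : ∀ v, vbl v ⊆ vars
  /-- the combinations of values of the variables in `vbl v` for which the event `v` occurs -/
  bad : (v : Fin n) → Set ((i : vbl v) → Val i)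
  measurableSet_bad : ∀ v, MeasurableSet (bad v)

/-- What a node of the dependency graph knows about the instance: the variables that its event
depends on, their distributions, and the combinations of their values for which it occurs. -/
structure LLLNodeInput {ι : Type u} (Val : ι → Type w)
    [∀ i, MeasurableSpace (Val i)] where
  vbl : Finset ι
  law : (i : vbl) → Measure (Val i)
  bad : Set ((i : vbl) → Val i)

/-- The output of a node: values for some of the variables. -/
abbrev LLLNodeOutput {ι : Type u} (Val : ι → Type w) : Type (max u w) :=
  (i : ι) → Option (Val i)

namespace LLLInstance

variable {ι : Type*} {Val : ι → Type*} [∀ i, MeasurableSpace (Val i)] {n : ℕ}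

attribute [instance] mΩ isProb

/-- The restriction of an assignment of values to the variables of the event `v`. -/
def restrict (I : LLLInstance Val n) (x : (i : I.vars) → Val i) (v : Fin n) :
    (i : I.vbl v) → Val i :=
  fun i => x ⟨i, I.vbl_subset v i.2⟩

/-- The event `v`, as a subset of the probability space. -/
def event (I : LLLInstance Val n) (v : Fin n) : Set I.Ω :=
  {ω | I.restrict (fun i => I.X i ω) v ∈ I.bad v}

/-- The dependency graph: its nodes are the events, and two different events are adjacent if they
share a variable. -/
def dependencyGraph (I : LLLInstance Val n) : SimpleGraph (Fin n) where
  Adj u v := u ≠ v ∧ ∃ i, i ∈ I.vbl u ∧ i ∈ I.vbl v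
  symm := ⟨fun _ _ h => ⟨h.1.symm, h.2.imp fun _ hi => hi.symm⟩⟩
  loopless := ⟨fun _ h => h.1 rfl⟩

/-- The local inputs of the nodes. -/
def nodeInput (I : LLLInstance Val n) (v : Fin n) : LLLNodeInput Val where
  vbl := I.vbl v
  law := fun i => I.P.map (I.X ⟨i, I.vbl_subset v i.2⟩)
  bad := I.bad v

/-- The outputs of the nodes solve the instance: every node outputs a value for each variable that
its event depends on, all of these values come from one assignment (so nodes that share a variable
agree on its value), and none of the events occurs under it. -/
def IsSolution (I : LLLInstance Val n) (out : Fin n → LLLNodeOutput Val) : Prop :=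
  ∃ x : (i : I.vars) → Val i,
    (∀ v, ∀ i : I.vbl v, out v i = some (I.restrict x v i)) ∧ ∀ v, I.restrict x v ∉ I.bad v

end LLLInstance

end

/-!
# The Lovász Local Lemma below the threshold `p * 2 ^ d < 1` in `O(d ^ 2 + log* n)` rounds

The variables are fixed one after the other, with the following bookkeeping. Every ordered pair
`(u, v)` of events has a weight `φ u v > 0`, with `φ u v + φ v u = 2`, and with `φ u v = 1` if `u`
and `v` are not adjacent. The weights are admissible (`LLLInstance.Admissible`) if, given the
values fixed so far, the probability of every event `v` is less than `2 ^ (-d) * ∏ u, φ v u`. At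
the start all weights are `1`, and they are admissible because `p * 2 ^ d < 1`. When all
variables are fixed, the product is at most `2 ^ d`, so every event has probability less than `1`,
and does not occur.

**Fixing one variable.** The events that depend on a variable form a clique, and only weights
inside the clique are changed. The bounds `y` on the probabilities that weights on a clique can
achieve are those with `y i ≤ ∏ j, φ i j`. By duality between weights and points of the simplex,
for positive `y` this is equivalent to `∑ i, μ i * log (y i) ≤ pairEntropy μ` for every
probability vector `μ`, and then weights of the special form `2 * la i / (la i + la j)` suffice
(`exists_le_prod_of_le_pairEntropy`). Among the positive vectors, those that are not achievable
form a convex set: through each achievable `a` there is a hyperplane, with normal vector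
`la i / a i`, such that all positive vectors on the near side of it are achievable
(`sum_mul_log_le_pairEntropy_of_hyperplane`). This amounts to the inequality
`sum_mul_log_add_relEnt_le_pairEntropy`: the relative entropy of two distributions is at most the
sum of the relative entropies of their restrictions to pairs of points. It reduces to three
points, where it follows from `log r ≤ r - 1` and a sum of squares (`relEnt_three`). Since the
linear form defining the hyperplane takes at some value of the variable at most its expectation,
this value and suitable new weights preserve admissibility (`exists_point_and_weights`).

**Distributed implementation.** Fixing all variables of an event `v` changes only what is stored
at `v` and its neighbours, and the decision depends only on what is stored there. So events at
distance more than `2` can act at the same time (`LLLInstance.Represents.exists_act`), and it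
suffices to colour the graph of pairs at distance at most `2`, whose degrees are at most
`D = d + d ^ 2`, with `O(D)` colours, and to let the colour classes act in turn. The colouring
(`exists_canReduce`) starts with the identifiers. In `log* n` rounds polynomials over finite
fields bring the number of colours down to a polynomial in `D`. After that every node moves
through a prime field of order `q = O(D)` along the values of a polynomial of degree `4`, and
stops as soon as it meets none of its neighbours; it meets each of them a bounded number of times,
so that all nodes stop, at different positions for adjacent nodes, within `q` rounds. One step on
the graph of pairs at distance at most `2` takes two rounds of communication
(`twoHopAlgorithm_outputsWithin`). For `d = 0` and `n = 1` there is no time for any communication,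
and the case `d = 0`, where no two events share a variable, is treated apart.
-/

/-! ### An inequality for relative entropies of pairs -/

lemma mul_log_le_mul_log_add {a p r : ℝ} (ha : 0 ≤ a)
    (hap : a ≠ 0 → 0 < p) (har : a ≠ 0 → 0 < r) :
    a * Real.log p ≤ a * Real.log r + (a / r * p - a) := by
  rcases eq_or_ne a 0 with rfl | h
  · simp
  · have hp' := hap h
    have hr' := har h
    have h1 := Real.log_le_sub_one_of_pos (div_pos hp' hr')
    rw [Real.log_div hp'.ne' hr'.ne'] at h1
    have h2 := mul_le_mul_of_nonneg_left h1 ha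
    have h3 : a * (p / r - 1) = a / r * p - a := by ring
    linarith

/-- The quadratic inequality behind `relEnt_three`: the difference of the two sides is a sum of
squares `(a * m - b * l) ^ 2` with nonnegative coefficients. -/
lemma sum_mul_pair_div_le {a b c l m n : ℝ} (hl : 0 < l) (hm : 0 < m) (hn : 0 < n) :
    l * ((a + b) * (a + c)) / ((l + m) * (l + n)) + m * ((a + b) * (b + c)) / ((l + m) * (m + n))
      + n * ((a + c) * (b + c)) / ((l + n) * (m + n)) ≤ (a + b + c) ^ 2 / (l + m + n) := by
  have key : (a + b + c) ^ 2 / (l + m + n) - (l * ((a + b) * (a + c)) / ((l + m) * (l + n))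
      + m * ((a + b) * (b + c)) / ((l + m) * (m + n))
      + n * ((a + c) * (b + c)) / ((l + n) * (m + n)))
      = (n * (a * m - b * l) ^ 2 + m * (a * n - c * l) ^ 2 + l * (b * n - c * m) ^ 2)
        / ((l + m + n) * ((l + m) * (l + n) * (m + n))) := by
    field_simp
    ring
  have : 0 ≤ (n * (a * m - b * l) ^ 2 + m * (a * n - c * l) ^ 2 + l * (b * n - c * m) ^ 2)
        / ((l + m + n) * ((l + m) * (l + n) * (m + n))) := by positivity
  linarith

/-- The contribution `x log (x / l)` of a point to the relative entropy of two (unnormalized)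
measures that give it the masses `x` and `l`. -/
noncomputable def relEnt (x l : ℝ) : ℝ := x * Real.log (x / l)

/-- The contribution of one point to `relEnt_three`, bounded with `log r ≤ r - 1`. -/
lemma relEnt_term {a b c l m n : ℝ} (ha : 0 ≤ a) (hb : 0 ≤ b) (hc : 0 ≤ c)
    (hl : 0 < l) (hm : 0 < m) (hn : 0 < n) :
    a - (l + m + n) / (a + b + c) * (l * ((a + b) * (a + c)) / ((l + m) * (l + n))) ≤
      a * (Real.log ((a + b + c) / (l + m + n)) + Real.log (a / l)
        - Real.log ((a + b) / (l + m)) - Real.log ((a + c) / (l + n))) := by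
  rcases ha.eq_or_lt with rfl | ha
  · have : 0 ≤ (l + m + n) / (0 + b + c) * (l * ((0 + b) * (0 + c)) / ((l + m) * (l + n))) := by
      positivity
    linarith
  · have h1 := Real.log_le_sub_one_of_pos (x := (a + b) / (l + m) * ((a + c) / (l + n)) /
      ((a + b + c) / (l + m + n) * (a / l))) (by positivity)
    rw [Real.log_div (by positivity) (by positivity), Real.log_mul (by positivity) (by positivity),
      Real.log_mul (by positivity) (by positivity)] at h1
    have h2 := mul_le_mul_of_nonneg_left h1 ha.le
    have h3 : a * ((a + b) / (l + m) * ((a + c) / (l + n)) /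
        ((a + b + c) / (l + m + n) * (a / l)) - 1) =
        (l + m + n) / (a + b + c) * (l * ((a + b) * (a + c)) / ((l + m) * (l + n))) - a := by
      field_simp
    rw [h3] at h2
    linarith

/-- For two measures on three points, the relative entropy is at most the sum of the relative
entropies of their restrictions to the three pairs of points. -/
lemma relEnt_three {a b c l m n : ℝ} (ha : 0 ≤ a) (hb : 0 ≤ b) (hc : 0 ≤ c)
    (hl : 0 < l) (hm : 0 < m) (hn : 0 < n) :
    relEnt (b + c) (m + n) + relEnt (a + b) (l + m) + relEnt (a + c) (l + n) ≤
      relEnt (a + b + c) (l + m + n) + relEnt a l + relEnt b m + relEnt c n := by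
  have hX : 0 ≤ a + b + c := by positivity
  rcases hX.eq_or_lt with hX | hX
  · have h1 : a = 0 := by linarith
    have h2 : b = 0 := by linarith
    have h3 : c = 0 := by linarith
    simp [h1, h2, h3, relEnt]
  have h1 := relEnt_term ha hb hc hl hm hn
  have h2 := relEnt_term hb ha hc hm hl hn
  have h3 := relEnt_term hc ha hb hn hl hm
  have h4 := mul_le_mul_of_nonneg_left (sum_mul_pair_div_le (a := a) (b := b) (c := c) hl hm hn)
    (show 0 ≤ (l + m + n) / (a + b + c) by positivity)
  have h5 : (l + m + n) / (a + b + c) * ((a + b + c) ^ 2 / (l + m + n)) = a + b + c := by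
    field_simp
  rw [h5] at h4
  rw [show b + a + c = a + b + c by ring, show m + l + n = l + m + n by ring, add_comm b a,
    add_comm m l] at h2
  rw [show c + a + b = a + b + c by ring, show n + l + m = l + m + n by ring, add_comm c a,
    add_comm n l, add_comm c b, add_comm n m] at h3
  unfold relEnt
  linarith

/-- The relative entropy of a point and a merged set of points is at most the sum over the points of
the set; the points are merged one at a time with `relEnt_three`. -/
lemma relEnt_add_sum_le {κ : Type*} (S : Finset κ) (μ la : κ → ℝ) (hμ : ∀ i, 0 ≤ μ i)
    (hla : ∀ i, 0 < la i) (i : κ) :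
    relEnt (μ i) (la i) + relEnt (∑ j ∈ S, μ j) (∑ j ∈ S, la j)
        - relEnt (μ i + ∑ j ∈ S, μ j) (la i + ∑ j ∈ S, la j) ≤
      ∑ j ∈ S, (relEnt (μ i) (la i) + relEnt (μ j) (la j)
        - relEnt (μ i + μ j) (la i + la j)) := by
  classical
  induction S using Finset.induction_on with
  | empty => simp [relEnt]
  | insert k S hk ih =>
    rcases S.eq_empty_or_nonempty with rfl | hS
    · simp
    · rw [Finset.sum_insert hk, Finset.sum_insert hk, Finset.sum_insert hk]
      have h := relEnt_three (hμ i) (hμ k) (Finset.sum_nonneg fun j (_ : j ∈ S) => hμ j)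
        (hla i) (hla k) (Finset.sum_pos (fun j (_ : j ∈ S) => hla j) hS)
      rw [add_assoc (μ i), add_assoc (la i), add_assoc (relEnt _ _)] at h
      linarith

/-- The left-hand side is twice a relative entropy. The factor `2` accounts for the two orders of
each pair, and the pairs with equal entries contribute zero. -/
lemma two_mul_sum_relEnt_sub_le {κ : Type*} (S : Finset κ) (μ la : κ → ℝ) (hμ : ∀ i, 0 ≤ μ i)
    (hla : ∀ i, 0 < la i) :
    2 * (∑ i ∈ S, relEnt (μ i) (la i) - relEnt (∑ j ∈ S, μ j) (∑ j ∈ S, la j)) ≤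
      ∑ i ∈ S, ∑ j ∈ S, (relEnt (μ i) (la i) + relEnt (μ j) (la j)
        - relEnt (μ i + μ j) (la i + la j)) := by
  classical
  induction S using Finset.induction_on with
  | empty => simp [relEnt]
  | insert k S hk ih =>
    have h := relEnt_add_sum_le S μ la hμ hla k
    have hd : relEnt (μ k + μ k) (la k + la k) = 2 * relEnt (μ k) (la k) := by
      unfold relEnt
      rw [← two_mul, ← two_mul, mul_div_mul_left _ _ two_ne_zero]
      ring
    simp only [Finset.sum_insert hk, Finset.sum_add_distrib (f := fun i => relEnt (μ i) (la i)
      + relEnt (μ k) (la k) - relEnt (μ i + μ k) (la i + la k))]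
    have hsymm : ∑ i ∈ S, (relEnt (μ i) (la i) + relEnt (μ k) (la k)
          - relEnt (μ i + μ k) (la i + la k)) =
        ∑ j ∈ S, (relEnt (μ k) (la k) + relEnt (μ j) (la j)
          - relEnt (μ k + μ j) (la k + la j)) := by
      refine Finset.sum_congr rfl fun j _ => ?_
      rw [add_comm (μ j), add_comm (la j)]
      ring
    rw [hsymm]
    linarith

/-- `∑ᵢⱼ μᵢ log (2 μᵢ / (μᵢ + μⱼ))`, the sum over all ordered pairs (those with `i = j` contribute
zero). It is the largest value that `∑ᵢⱼ μᵢ log pᵢⱼ` takes for `pᵢⱼ > 0` with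
`pᵢⱼ + pⱼᵢ = 2`. -/
noncomputable def pairEntropy {κ : Type*} [Fintype κ] (μ : κ → ℝ) : ℝ :=
  ∑ i, ∑ j, μ i * Real.log (2 * μ i / (μ i + μ j))

section Entropy

variable {κ : Type*} [Fintype κ]

/-- Gibbs' inequality for all pairs. -/
lemma sum_mul_log_le_pairEntropy {μ : κ → ℝ} (hμ : ∀ i, 0 ≤ μ i) {p : κ → κ → ℝ}
    (hp : ∀ i j, 0 ≤ p i j) (hpos : ∀ i j, μ i ≠ 0 → 0 < p i j)
    (hsum : ∀ i j, p i j + p j i ≤ 2) :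
    ∑ i, ∑ j, μ i * Real.log (p i j) ≤ pairEntropy μ := by
  have h1 : ∀ i j, μ i * Real.log (p i j) ≤ μ i * Real.log (2 * μ i / (μ i + μ j)) +
      ((μ i + μ j) * p i j / 2 - μ i) := by
    intro i j
    have hi := hμ i
    have hj := hμ j
    have := mul_log_le_mul_log_add (hμ i) (r := 2 * μ i / (μ i + μ j)) (hpos i j)
       (fun h => by
        have : 0 < μ i := lt_of_le_of_ne hi h.symm
        positivity)
    refine this.trans ?_
    rcases hi.eq_or_lt with h | h
    · rw [← h]
      have := hp i j
      simp
      positivity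
    · apply le_of_eq
      have : 0 < μ i + μ j := by positivity
      field_simp
  have h2 : ∑ i, ∑ j, ((μ i + μ j) * p i j / 2 - μ i) ≤ 0 := by
    have h3 : ∑ i, ∑ j, ((μ i + μ j) * p i j / 2 - μ i)
        = ∑ i, ∑ j, ((μ i + μ j) * p j i / 2 - μ j) := by
      rw [Finset.sum_comm]
      refine Finset.sum_congr rfl fun i _ => Finset.sum_congr rfl fun j _ => ?_
      rw [add_comm]
    have h4 : ∑ i, ∑ j, (((μ i + μ j) * p i j / 2 - μ i) + ((μ i + μ j) * p j i / 2 - μ j))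
        ≤ 0 := by
      refine Finset.sum_nonpos fun i _ => Finset.sum_nonpos fun j _ => ?_
      have := mul_le_mul_of_nonneg_left (hsum i j) (add_nonneg (hμ i) (hμ j))
      linarith
    simp only [Finset.sum_add_distrib] at h4
    rw [← h3] at h4
    linarith
  calc ∑ i, ∑ j, μ i * Real.log (p i j)
      ≤ ∑ i, ∑ j, (μ i * Real.log (2 * μ i / (μ i + μ j)) +
      ((μ i + μ j) * p i j / 2 - μ i)) :=
        Finset.sum_le_sum fun i _ => Finset.sum_le_sum fun j _ => h1 i j
    _ ≤ pairEntropy μ := by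
        simp only [Finset.sum_add_distrib (g := fun j => ((μ _ + μ j) * p _ j / 2 - μ _))]
        rw [Finset.sum_add_distrib]
        unfold pairEntropy
        linarith

/-- The relative entropy of two probability distributions is at most the sum over all pairs of
points of the relative entropies of their restrictions to the pair. -/
lemma sum_mul_log_add_relEnt_le_pairEntropy {μ la : κ → ℝ} (hμ : ∀ i, 0 ≤ μ i)
    (hla : ∀ i, 0 < la i) (hμ1 : ∑ i, μ i = 1) (hla1 : ∑ i, la i = 1) :
    ∑ i, ∑ j, μ i * Real.log (2 * la i / (la i + la j)) + ∑ i, relEnt (μ i) (la i)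
      ≤ pairEntropy μ := by
  have h := two_mul_sum_relEnt_sub_le Finset.univ μ la hμ hla
  rw [hμ1, hla1] at h
  set d : κ → κ → ℝ := fun i j =>
    μ i * Real.log (2 * μ i / (μ i + μ j)) - μ i * Real.log (2 * la i / (la i + la j)) with hd
  have hdd : ∀ i j, relEnt (μ i) (la i) + relEnt (μ j) (la j)
        - relEnt (μ i + μ j) (la i + la j) = d i j + d j i := by
    have h1 : ∀ i j, d i j = μ i * Real.log (μ i / la i) -
        μ i * Real.log ((μ i + μ j) / (la i + la j)) := by
      intro i j
      rcases (hμ i).eq_or_lt with h | h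
      · simp [hd, ← h]
      · have hi := hla i
        have hj := hla j
        have hj' := hμ j
        simp only [hd]
        rw [← mul_sub, ← mul_sub, ← Real.log_div (by positivity) (by positivity),
          ← Real.log_div (by positivity) (by positivity)]
        congr 2
        field_simp
    intro i j
    rw [h1, h1 j i, add_comm (μ j), add_comm (la j)]
    unfold relEnt
    ring
  have h2 : ∑ i, ∑ j, (relEnt (μ i) (la i) + relEnt (μ j) (la j)
        - relEnt (μ i + μ j) (la i + la j)) = 2 * ∑ i, ∑ j, d i j := by
    simp only [hdd, Finset.sum_add_distrib]
    rw [Finset.sum_comm (f := fun i j => d j i)]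
    ring
  rw [h2] at h
  simp only [hd, Finset.sum_sub_distrib] at h
  have h3 : relEnt 1 1 = 0 := by simp [relEnt]
  rw [h3] at h
  unfold pairEntropy
  linarith

/-- An expression that is continuous also where coordinates vanish. -/
lemma pairEntropy_eq {μ : κ → ℝ} (hμ : ∀ i, 0 ≤ μ i) :
    pairEntropy μ = ∑ i, ∑ j, (μ i * Real.log 2 - Real.negMulLog (μ i)
      + Real.negMulLog (μ i + μ j) / 2) := by
  have h1 : ∀ i j, μ i * Real.log (2 * μ i / (μ i + μ j)) =
      (μ i * Real.log 2 - Real.negMulLog (μ i) + Real.negMulLog (μ i + μ j) / 2)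
      + (μ j * Real.log (μ i + μ j) / 2 - μ i * Real.log (μ i + μ j) / 2) := by
    intro i j
    rcases (hμ i).eq_or_lt with h | h
    · simp [← h, Real.negMulLog]
      ring
    · have := hμ j
      rw [Real.log_div (by positivity) (by positivity), Real.log_mul (by positivity)
        (by positivity)]
      unfold Real.negMulLog
      ring
  have h2 : ∑ i, ∑ j, (μ j * Real.log (μ i + μ j) / 2 - μ i * Real.log (μ i + μ j) / 2) = 0 := by
    simp only [Finset.sum_sub_distrib]
    rw [Finset.sum_comm, sub_eq_zero]
    refine Finset.sum_congr rfl fun i _ => Finset.sum_congr rfl fun j _ => ?_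
    rw [add_comm (μ j)]
  unfold pairEntropy
  rw [← add_zero (∑ i, ∑ j, (μ i * Real.log 2 - Real.negMulLog (μ i)
      + Real.negMulLog (μ i + μ j) / 2)), ← h2, ← Finset.sum_add_distrib]
  refine Finset.sum_congr rfl fun i _ => ?_
  rw [← Finset.sum_add_distrib]
  exact Finset.sum_congr rfl fun j _ => h1 i j

end Entropy

/-! ### Fixing the value of one variable -/

section Weights

variable {κ : Type*} [Fintype κ]

/-- If every `∑ᵢ μᵢ log yᵢ` is bounded by the pair entropy of `μ`, then `y` is dominated by products
of weights of the form `2 laᵢ / (laᵢ + laⱼ)`. Here `la` is a minimizer on the simplex of the slack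
`pairEntropy μ - ∑ᵢ μᵢ log yᵢ`; comparing it with points on the segment towards the `i`-th vertex
gives the bound for `yᵢ`. -/
lemma exists_le_prod_of_le_pairEntropy [Nonempty κ] {y : κ → ℝ} (hy : ∀ i, 0 < y i)
    (h : ∀ μ ∈ stdSimplex ℝ κ, ∑ i, μ i * Real.log (y i) ≤ pairEntropy μ) :
    ∃ la : κ → ℝ, (∀ i, 0 < la i) ∧ ∑ i, la i = 1 ∧
      ∀ i, y i ≤ ∏ j, 2 * la i / (la i + la j) := by
  classical
  obtain ⟨μ, hμ, hmin⟩ : ∃ μ ∈ stdSimplex ℝ κ, ∀ ν ∈ stdSimplex ℝ κ,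
      pairEntropy μ - ∑ i, μ i * Real.log (y i) ≤ pairEntropy ν - ∑ i, ν i * Real.log (y i) := by
    obtain ⟨μ, hμ, hmin⟩ := (isCompact_stdSimplex ℝ κ).exists_isMinOn
      (f := fun μ => ∑ i, ∑ j, (μ i * Real.log 2 - Real.negMulLog (μ i)
      + Real.negMulLog (μ i + μ j) / 2) - ∑ i, μ i * Real.log (y i))
      ⟨_, single_mem_stdSimplex ℝ (Classical.arbitrary κ)⟩ (by fun_prop)
    refine ⟨μ, hμ, fun ν hν => ?_⟩
    rw [pairEntropy_eq hμ.1, pairEntropy_eq hν.1]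
    exact hmin hν
  have hμ0 := hμ.1
  have key : ∀ i, ∀ s ∈ Set.Ioo (0 : ℝ) 1, y i ≤ ∏ j, 2 * ((1 - s) * μ i + s) /
      (((1 - s) * μ i + s) + ((1 - s) * μ j + if j = i then s else 0)) := by
    intro i s hs
    set ν : κ → ℝ := fun j => (1 - s) * μ j + if j = i then s else 0 with hν
    have hs0 := hs.1
    have hs1 : 0 < 1 - s := by linarith [hs.2]
    have hνi : ν i = (1 - s) * μ i + s := by simp [hν]
    have hν0 : ∀ j, 0 ≤ ν j := fun j => by
      have := hμ0 j
      simp only [hν]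
      split_ifs <;> positivity
    have hνpos : ∀ j, μ j ≠ 0 → 0 < ν j := fun j hj => by
      have : 0 < μ j := lt_of_le_of_ne (hμ0 j) hj.symm
      simp only [hν]
      split_ifs <;> positivity
    have hνi0 : 0 < ν i := by
      have := hμ0 i
      rw [hνi]
      positivity
    have hνmem : ν ∈ stdSimplex ℝ κ := by
      refine ⟨hν0, ?_⟩
      simp only [hν, Finset.sum_add_distrib, ← Finset.mul_sum, hμ.2]
      simp
    set g : κ → ℝ := fun k => ∑ j, Real.log (2 * ν k / (ν k + ν j)) - Real.log (y k) with hg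
    have h1 : pairEntropy ν - ∑ k, ν k * Real.log (y k) = ∑ k, ν k * g k := by
      simp only [hg, pairEntropy, mul_sub, Finset.sum_sub_distrib, Finset.mul_sum]
    have h2 : ∑ k, μ k * g k ≤ pairEntropy μ - ∑ k, μ k * Real.log (y k) := by
      simp only [hg, mul_sub, Finset.sum_sub_distrib, Finset.mul_sum]
      refine sub_le_sub_right (sum_mul_log_le_pairEntropy hμ0
        (p := fun k j => 2 * ν k / (ν k + ν j)) ?_ ?_ ?_) _
      · intro k j
        have := hν0 k
        have := hν0 j
        positivity
      · intro k j hk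
        have := hνpos k hk
        have := hν0 j
        positivity
      · intro k j
        have h3 : 2 * ν k / (ν k + ν j) + 2 * ν j / (ν j + ν k)
            = 2 * ((ν k + ν j) / (ν k + ν j)) := by
          rw [add_comm (ν j)]
          ring
        rw [h3]
        linarith [div_self_le_one (ν k + ν j)]
    have h3 : ∑ k, ν k * g k = (1 - s) * ∑ k, μ k * g k + s * g i := by
      simp only [hν, add_mul, Finset.sum_add_distrib, Finset.mul_sum, ite_mul, zero_mul, mul_assoc]
      simp
    have h4 := hmin ν hνmem
    have h5 := h μ hμ
    have h6 : 0 ≤ g i := by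
      rw [h1, h3] at h4
      have h7 := mul_le_mul_of_nonneg_left h2 hs1.le
      have h8 : 0 ≤ s * g i := by nlinarith
      exact nonneg_of_mul_nonneg_right h8 hs0
    have h7 : Real.log (y i) ≤ Real.log (∏ j, 2 * ν i / (ν i + ν j)) := by
      rw [Real.log_prod]
      · simp only [hg] at h6
        linarith
      · intro j _
        have := hν0 j
        positivity
    have h8 := (Real.log_le_log_iff (hy i) (Finset.prod_pos fun j _ => by
        have := hν0 j
        positivity)).1 h7
    simpa only [hνi] using h8
  have hmem : Set.Ioo (0 : ℝ) 1 ∈ nhdsWithin (0 : ℝ) (Set.Ioi 0) := Ioo_mem_nhdsGT one_pos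
  have hpos : ∀ i, 0 < μ i := by
    intro i
    by_contra hi
    have hi : μ i = 0 := le_antisymm (not_lt.1 hi) (hμ0 i)
    obtain ⟨k, hk⟩ : ∃ k, 0 < μ k := by
      by_contra! hc
      have := Finset.sum_nonpos fun k (_ : k ∈ Finset.univ) => hc k
      rw [hμ.2] at this
      linarith
    have hki : k ≠ i := fun e => by rw [e, hi] at hk; exact lt_irrefl _ hk
    -- all factors are at most `2`, and the one for `k` tends to zero
    have hbd : ∀ s ∈ Set.Ioo (0 : ℝ) 1,
        y i ≤ 2 * s / (s + (1 - s) * μ k) * 2 ^ (Finset.univ.erase k).card := by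
      intro s hs
      have hs0 := hs.1
      have hs1 : 0 < 1 - s := by linarith [hs.2]
      refine (key i s hs).trans ?_
      rw [← Finset.mul_prod_erase _ _ (Finset.mem_univ k)]
      simp only [hi, hki, if_false, mul_zero, zero_add, add_zero]
      refine mul_le_mul_of_nonneg_left ?_ (by positivity)
      rw [← Finset.prod_const]
      have hj : ∀ j, 0 ≤ (1 - s) * μ j + if j = i then s else 0 := fun j => by
        have := hμ0 j
        split_ifs <;> positivity
      refine Finset.prod_le_prod (fun j _ => ?_) fun j _ => ?_
      · have := hj j
        positivity
      · have := hj j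
        rw [div_le_iff₀ (by positivity)]
        linarith
    have hlim : Filter.Tendsto (fun s : ℝ => 2 * s / (s + (1 - s) * μ k) *
        2 ^ (Finset.univ.erase k).card) (nhdsWithin 0 (Set.Ioi 0)) (nhds 0) := by
      have : ContinuousAt (fun s : ℝ => 2 * s / (s + (1 - s) * μ k) *
          2 ^ (Finset.univ.erase k).card) 0 := by
        refine ContinuousAt.mul (ContinuousAt.div (by fun_prop) (by fun_prop) ?_) (by fun_prop)
        simpa using hk.ne'
      have h0 := this.tendsto
      simp only [mul_zero, zero_div, zero_mul] at h0
      exact h0.mono_left nhdsWithin_le_nhds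
    have := ge_of_tendsto hlim (Filter.mem_of_superset hmem hbd)
    exact absurd (hy i) (not_lt.2 this)
  refine ⟨μ, hpos, hμ.2, fun i => ?_⟩
  have hlim : Filter.Tendsto (fun s : ℝ => ∏ j, 2 * ((1 - s) * μ i + s) /
      (((1 - s) * μ i + s) + ((1 - s) * μ j + if j = i then s else 0)))
      (nhdsWithin 0 (Set.Ioi 0)) (nhds (∏ j, 2 * μ i / (μ i + μ j))) := by
    refine Filter.Tendsto.mono_left ?_ nhdsWithin_le_nhds
    refine tendsto_finsetProd _ fun j _ => ?_
    have : ContinuousAt (fun s : ℝ => 2 * ((1 - s) * μ i + s) /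
      (((1 - s) * μ i + s) + ((1 - s) * μ j + if j = i then s else 0))) 0 := by
      refine ContinuousAt.div (by fun_prop) ?_ ?_
      · split_ifs <;> fun_prop
      · have := hpos i
        have := hpos j
        have : 0 < μ i + μ j := by positivity
        simpa using this.ne'
    simpa using this.tendsto
  exact ge_of_tendsto hlim (Filter.mem_of_superset hmem (key i))

/-- If `a` is dominated by the products of the weights given by `la`, then so is (for other
weights) every positive `y` on the near side of the hyperplane `∑ᵢ laᵢ yᵢ / aᵢ = 1` through `a`. -/
lemma sum_mul_log_le_pairEntropy_of_hyperplane {a la y μ : κ → ℝ} (ha : ∀ i, 0 < a i)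
    (hla : ∀ i, 0 < la i) (hla1 : ∑ i, la i = 1) (hle : ∀ i, a i ≤ ∏ j, 2 * la i / (la i + la j))
    (hy : ∀ i, 0 < y i) (hsum : ∑ i, la i * y i / a i ≤ 1) (hμ : μ ∈ stdSimplex ℝ κ) :
    ∑ i, μ i * Real.log (y i) ≤ pairEntropy μ := by
  have h0 := sum_mul_log_add_relEnt_le_pairEntropy hμ.1 hla hμ.2 hla1
  have h1 : ∀ i, μ i * Real.log (y i) ≤ ∑ j, μ i * Real.log (2 * la i / (la i + la j)) +
      relEnt (μ i) (la i) + (la i * y i / a i - μ i) := by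
    intro i
    have hai := ha i
    have hli := hla i
    have hyi := hy i
    rcases (hμ.1 i).eq_or_lt with h | h
    · rw [← h]
      simp [relEnt]
      positivity
    · have h2 : Real.log (a i) ≤ ∑ j, Real.log (2 * la i / (la i + la j)) := by
        rw [← Real.log_prod (fun j _ => by have := hla j; positivity)]
        exact Real.log_le_log hai (hle i)
      have h3 := mul_log_le_mul_log_add (hμ.1 i) (p := la i * y i / a i) (r := μ i)
        (fun _ => by positivity) (fun _ => h)
      rw [div_self h.ne', one_mul, Real.log_div (by positivity) hai.ne',
        Real.log_mul hli.ne' hyi.ne'] at h3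
      have h4 := mul_le_mul_of_nonneg_left h2 h.le
      rw [← Finset.mul_sum]
      unfold relEnt
      rw [Real.log_div h.ne' hli.ne']
      linarith
  have h2 := Finset.sum_le_sum fun i (_ : i ∈ Finset.univ) => h1 i
  simp only [Finset.sum_add_distrib, Finset.sum_sub_distrib, hμ.2] at h2
  linarith

/-- The step of the weighted derandomization: if the expectations of `fᵢ` are bounded by the
products of the weights of the pairs containing `i`, then there are a point `x` and new weights
for which the values `fᵢ x` satisfy these bounds. -/
theorem exists_point_and_weights {α : Type*} [MeasurableSpace α] (ρ : Measure α)
    [IsProbabilityMeasure ρ] {φ : κ → κ → ℝ} (hpos : ∀ i j, 0 < φ i j)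
    (hsum : ∀ i j, φ i j + φ j i = 2) {R : κ → ℝ} (hR : ∀ i, 0 < R i) {f : κ → α → ℝ}
    (hf : ∀ i x, 0 ≤ f i x) (hint : ∀ i, Integrable (f i) ρ)
    (h : ∀ i, ∫ x, f i x ∂ρ < R i * ∏ j, φ i j) :
    ∃ x, ∃ ψ : κ → κ → ℝ, (∀ i j, 0 < ψ i j) ∧ (∀ i j, ψ i j + ψ j i = 2) ∧
      ∀ i, f i x < R i * ∏ j, ψ i j := by
  rcases isEmpty_or_nonempty κ with he | he
  · have : Nonempty α := nonempty_of_isProbabilityMeasure ρ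
    exact ⟨Classical.arbitrary α, φ, hpos, hsum, fun i => isEmptyElim i⟩
  set a : κ → ℝ := fun i => ∏ j, φ i j with ha
  have ha0 : ∀ i, 0 < a i := fun i => Finset.prod_pos fun j _ => hpos i j
  obtain ⟨la, hla, hla1, hle⟩ := exists_le_prod_of_le_pairEntropy ha0 (fun μ hμ => by
    have := sum_mul_log_le_pairEntropy hμ.1 (p := φ) (fun i j => (hpos i j).le)
      (fun i j _ => hpos i j) (fun i j => (hsum i j).le)
    refine le_trans (le_of_eq ?_) this
    refine Finset.sum_congr rfl fun i _ => ?_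
    rw [Real.log_prod (fun j _ => (hpos i j).ne'), Finset.mul_sum])
  have hI : ∫ x, ∑ i, la i / (a i * R i) * f i x ∂ρ < 1 := by
    rw [integral_finsetSum _ (fun i _ => (hint i).const_mul _), ← hla1]
    refine Finset.sum_lt_sum_of_nonempty Finset.univ_nonempty fun i _ => ?_
    rw [integral_const_mul]
    have hai := ha0 i
    have hRi := hR i
    have hli := hla i
    have h1 := mul_lt_mul_of_pos_left (h i) (show 0 < la i / (a i * R i) by positivity)
    have h2 : la i / (a i * R i) * (R i * a i) = la i := by field_simp
    exact h1.trans_eq h2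
  obtain ⟨x, hx⟩ := exists_le_integral (μ := ρ)
    (integrable_finsetSum Finset.univ (fun i _ => (hint i).const_mul (la i / (a i * R i))))
  have hx1 := hx.trans_lt hI
  -- the room left is used to make all the coordinates positive
  obtain ⟨ε, hε, hε1⟩ : ∃ ε > 0, ∑ i, la i * (f i x / R i + ε) / a i ≤ 1 := by
    have hs : 0 < ∑ i, la i / a i :=
      Finset.sum_pos (fun i _ => div_pos (hla i) (ha0 i)) Finset.univ_nonempty
    refine ⟨(1 - ∑ i, la i / (a i * R i) * f i x) / ∑ i, la i / a i,
      div_pos (by linarith) hs, le_of_eq ?_⟩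
    set ε := (1 - ∑ i, la i / (a i * R i) * f i x) / ∑ i, la i / a i with hε
    have h1 : ∀ i, la i * (f i x / R i + ε) / a i =
        la i / (a i * R i) * f i x + la i / a i * ε := by
      intro i
      have hai := ha0 i
      have hRi := hR i
      field_simp
    simp only [h1, Finset.sum_add_distrib, ← Finset.sum_mul]
    rw [hε, mul_div_cancel₀ _ hs.ne']
    ring
  have hy0 : ∀ i, 0 < f i x / R i + ε := fun i => by
    have := div_nonneg (hf i x) (hR i).le
    positivity
  obtain ⟨lb, hlb, -, hlbe⟩ := exists_le_prod_of_le_pairEntropy hy0 (fun μ hμ =>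
    sum_mul_log_le_pairEntropy_of_hyperplane ha0 hla hla1 hle hy0 hε1 hμ)
  refine ⟨x, fun i j => 2 * lb i / (lb i + lb j), fun i j => ?_, fun i j => ?_, fun i => ?_⟩
  · have := hlb i
    have := hlb j
    positivity
  · have := hlb i
    have := hlb j
    field_simp
    ring
  · have h1 := hlbe i
    have hRi := hR i
    have h2 : f i x / R i < ∏ j, 2 * lb i / (lb i + lb j) := by linarith
    rwa [div_lt_iff₀ hRi, mul_comm] at h2

end Weights

/-! ### Conditional probabilities under partial assignments -/

lemma measurable_update_prod {J : Type*} [DecidableEq J] {α : J → Type*}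
    [∀ j, MeasurableSpace (α j)] (i : J) :
    Measurable (fun q : α i × (∀ j, α j) => Function.update q.2 i q.1) := by
  rw [measurable_pi_iff]
  intro j
  rcases eq_or_ne j i with rfl | h
  · simpa using measurable_fst
  · simp only [Function.update_of_ne h]
    exact (measurable_pi_apply j).comp measurable_snd

lemma pi_update_eq_map {J : Type*} [Fintype J] [DecidableEq J] {α : J → Type*}
    [∀ j, MeasurableSpace (α j)] (μ : ∀ j, Measure (α j)) [∀ j, IsProbabilityMeasure (μ j)]
    (i : J) (ρ : Measure (α i)) [IsProbabilityMeasure ρ] :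
    Measure.pi (Function.update μ i ρ) =
      (ρ.prod (Measure.pi μ)).map (fun q => Function.update q.2 i q.1) := by
  have hinst : ∀ j, IsProbabilityMeasure (Function.update μ i ρ j) := by
    intro j
    rcases eq_or_ne j i with rfl | h
    · rw [Function.update_self]; infer_instance
    · rw [Function.update_of_ne h]; infer_instance
  have hmeas := measurable_update_prod (α := α) i
  refine Measure.pi_eq fun s hs => ?_
  rw [Measure.map_apply hmeas (MeasurableSet.univ_pi hs)]
  have hpre : (fun q : α i × (∀ j, α j) => Function.update q.2 i q.1) ⁻¹' (Set.univ.pi s) =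
      s i ×ˢ Set.univ.pi (Function.update s i Set.univ) := by
    ext ⟨x, y⟩
    simp only [Set.mem_preimage, Set.mem_pi, Set.mem_univ, true_implies, Set.mem_prod]
    constructor
    · intro h
      refine ⟨by simpa using h i, fun j => ?_⟩
      rcases eq_or_ne j i with rfl | hj
      · simp
      · simpa [Function.update_of_ne hj] using h j
    · rintro ⟨h1, h2⟩ j
      rcases eq_or_ne j i with rfl | hj
      · simpa using h1
      · simpa [Function.update_of_ne hj] using h2 j
  rw [hpre, Measure.prod_prod, Measure.pi_pi, ← Finset.mul_prod_erase _ _ (Finset.mem_univ i),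
    ← Finset.mul_prod_erase _ (fun j => Function.update μ i ρ j (s j)) (Finset.mem_univ i)]
  simp only [Function.update_self, measure_univ, one_mul]
  congr 1
  refine Finset.prod_congr rfl fun j hj => ?_
  rw [Function.update_of_ne (Finset.ne_of_mem_erase hj),
    Function.update_of_ne (Finset.ne_of_mem_erase hj)]

/-- The law of total probability for a product measure, conditioned on one coordinate. -/
lemma measurable_pi_update_dirac_real {J : Type*} [Fintype J] [DecidableEq J] {α : J → Type*}
    [∀ j, MeasurableSpace (α j)] (μ : ∀ j, Measure (α j)) [∀ j, IsProbabilityMeasure (μ j)]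
    (i : J) {B : Set (∀ j, α j)} (hB : MeasurableSet B) :
    (Measurable fun x => (Measure.pi (Function.update μ i (Measure.dirac x))).real B) ∧
      ∫ x, (Measure.pi (Function.update μ i (Measure.dirac x))).real B ∂(μ i) =
        (Measure.pi μ).real B := by
  have hmeas := measurable_update_prod (α := α) i
  set S := (fun q : α i × (∀ j, α j) => Function.update q.2 i q.1) ⁻¹' B with hS
  have hSm : MeasurableSet S := hmeas hB
  have h1 : ∀ x, Measure.pi (Function.update μ i (Measure.dirac x)) B =
      Measure.pi μ (Prod.mk x ⁻¹' S) := by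
    intro x
    rw [pi_update_eq_map, Measure.map_apply hmeas hB, Measure.dirac_prod,
      Measure.map_apply measurable_prodMk_left hSm]
  have h2 : Measurable fun x => Measure.pi μ (Prod.mk x ⁻¹' S) := measurable_measure_prodMk_left hSm
  have h3 : Measure.pi μ B = ∫⁻ x, Measure.pi μ (Prod.mk x ⁻¹' S) ∂(μ i) := by
    have h := pi_update_eq_map μ i (μ i)
    rw [Function.update_eq_self] at h
    conv_lhs => rw [h]
    rw [Measure.map_apply hmeas hB, Measure.prod_apply hSm]
  simp only [Measure.real, h1]
  refine ⟨h2.ennreal_toReal, ?_⟩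
  rw [h3, integral_toReal h2.aemeasurable (Filter.Eventually.of_forall fun x => measure_lt_top _ _)]

section CondProb

variable {ι : Type u} {Val : ι → Type w} [∀ i, MeasurableSpace (Val i)]

namespace LLLNodeInput

/-- The law of a variable given the partial assignment `a`: a point mass if `a` assigns a value to
it, and its original law otherwise. -/
noncomputable def condLaw (x : LLLNodeInput Val) (a : LLLNodeOutput Val) (i : x.vbl) :
    Measure (Val i) :=
  (a i).elim (x.law i) Measure.dirac

/-- The probability of the event of a node given the partial assignment `a`, that is, when the
variables without a value in `a` are drawn independently from their laws. -/
noncomputable def condProb (x : LLLNodeInput Val) (a : LLLNodeOutput Val) : ℝ :=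
  (Measure.pi (x.condLaw a)).real x.bad

variable {x : LLLNodeInput Val} {a b : LLLNodeOutput Val}

lemma condProb_nonneg : 0 ≤ x.condProb a := measureReal_nonneg

lemma condProb_congr (h : ∀ i ∈ x.vbl, a i = b i) : x.condProb a = x.condProb b := by
  have : x.condLaw a = x.condLaw b := by
    funext i
    rw [condLaw, condLaw, h i i.2]
  rw [condProb, condProb, this]

lemma isProbabilityMeasure_condLaw (hx : ∀ i, IsProbabilityMeasure (x.law i)) (i : x.vbl) :
    IsProbabilityMeasure (x.condLaw a i) := by
  unfold condLaw
  cases a i with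
  | none => exact hx i
  | some v => exact Measure.dirac.isProbabilityMeasure

lemma condLaw_update [DecidableEq ι] {i : ι} (hi : i ∈ x.vbl) (v : Val i) :
    x.condLaw (Function.update a i (some v)) =
      Function.update (x.condLaw a) ⟨i, hi⟩ (Measure.dirac v) := by
  funext j
  obtain ⟨j, hj⟩ := j
  rcases eq_or_ne j i with rfl | h
  · simp [condLaw]
  · have h' : (⟨j, hj⟩ : x.vbl) ≠ ⟨i, hi⟩ := fun e => h (congrArg Subtype.val e)
    simp only [condLaw]
    rw [Function.update_of_ne h, Function.update_of_ne h', condLaw]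

lemma integrable_condProb_update [DecidableEq ι] (hx : ∀ i, IsProbabilityMeasure (x.law i))
    (hbad : MeasurableSet x.bad) {i : ι} (hi : i ∈ x.vbl) (ρ : Measure (Val i))
    [IsProbabilityMeasure ρ] :
    Integrable (fun v => x.condProb (Function.update a i (some v))) ρ := by
  have hinst := isProbabilityMeasure_condLaw (a := a) hx
  refine Integrable.of_bound (C := 1) ?_ (Filter.Eventually.of_forall fun v => ?_)
  · simp only [condProb, condLaw_update hi]
    exact (measurable_pi_update_dirac_real (x.condLaw a) ⟨i, hi⟩ hbad).1.aestronglyMeasurable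
  · have := isProbabilityMeasure_condLaw (a := Function.update a i (some v)) hx
    rw [Real.norm_of_nonneg condProb_nonneg]
    exact measureReal_le_one

lemma integral_condProb_update [DecidableEq ι] (hx : ∀ i, IsProbabilityMeasure (x.law i))
    (hbad : MeasurableSet x.bad) {i : ι} (hi : i ∈ x.vbl) (hai : a i = none) :
    ∫ v, x.condProb (Function.update a i (some v)) ∂(x.law ⟨i, hi⟩) = x.condProb a := by
  have hinst := isProbabilityMeasure_condLaw (a := a) hx
  have h := (measurable_pi_update_dirac_real (x.condLaw a) ⟨i, hi⟩ hbad).2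
  have hl : x.condLaw a ⟨i, hi⟩ = x.law ⟨i, hi⟩ := by simp [condLaw, hai]
  rw [hl] at h
  simp only [condProb, condLaw_update hi]
  exact h

lemma notMem_bad_of_condProb_lt_one (hbad : MeasurableSet x.bad) (y : (i : x.vbl) → Val i)
    (hy : ∀ i : x.vbl, a i = some (y i)) (h : x.condProb a < 1) : y ∉ x.bad := by
  intro hmem
  have h1 : x.condLaw a = fun i => Measure.dirac (y i) := by
    funext i
    simp [condLaw, hy i]
  have h2 : Measure.pi (x.condLaw a) = Measure.dirac y := by
    rw [h1]
    refine Measure.pi_eq fun s hs => ?_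
    rw [Measure.dirac_apply' _ (MeasurableSet.univ_pi hs)]
    classical
    simp only [Measure.dirac_apply' _ (hs _)]
    simp only [Set.indicator_apply, Pi.one_apply, Finset.prod_ite_zero]
    simp
  rw [condProb, h2, Measure.real, Measure.dirac_apply' _ hbad, Set.indicator_of_mem hmem] at h
  simp at h

end LLLNodeInput

namespace LLLInstance

variable {n : ℕ} (I : LLLInstance.{u, w, z} Val n)

lemma isProbabilityMeasure_law (v : Fin n) (i : (I.nodeInput v).vbl) :
    IsProbabilityMeasure ((I.nodeInput v).law i) :=
  Measure.isProbabilityMeasure_map (I.measurable_X _).aemeasurable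

lemma condProb_none (v : Fin n) :
    (I.nodeInput v).condProb (fun _ => none) = I.P.real (I.event v) := by
  have h1 : iIndepFun (fun i : I.vbl v => I.X ⟨i, I.vbl_subset v i.2⟩) I.P :=
    I.indep.precomp (g := fun i : I.vbl v => (⟨i, I.vbl_subset v i.2⟩ : I.vars))
      (fun i j h => Subtype.ext (congrArg (fun k : I.vars => (k : ι)) h))
  rw [iIndepFun_iff_map_fun_eq_pi_map (fun i => (I.measurable_X _).aemeasurable)] at h1
  have h2 : (I.nodeInput v).condLaw (fun _ => none) =
      fun i : I.vbl v => I.P.map (I.X ⟨i, I.vbl_subset v i.2⟩) := rfl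
  rw [LLLNodeInput.condProb, h2]
  change (Measure.pi fun i : I.vbl v => I.P.map (I.X ⟨i, I.vbl_subset v i.2⟩)).real (I.bad v) = _
  rw [← h1, Measure.real, Measure.map_apply (measurable_pi_lambda _ fun i => I.measurable_X _)
    (I.measurableSet_bad v)]
  rfl

/-- A partial assignment `a` of values to the variables together with weights `φ` on the ordered
pairs of events is admissible for the degree bound `d` if the two weights of each pair are positive
and add up to `2`, weights of nonadjacent pairs are `1`, and given `a` each event has probability
less than `2 ^ (-d)` times the product of its weights. -/
structure Admissible (d : ℕ) (a : LLLNodeOutput Val) (φ : Fin n → Fin n → ℝ) : Prop where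
  pos : ∀ u v, 0 < φ u v
  add_eq_two : ∀ u v, φ u v + φ v u = 2
  eq_one : ∀ u v, ¬ I.dependencyGraph.Adj u v → φ u v = 1
  condProb_lt : ∀ v, (I.nodeInput v).condProb a < (1 / 2) ^ d * ∏ u, φ v u

variable {I} {d : ℕ} {a : LLLNodeOutput Val} {φ : Fin n → Fin n → ℝ}

lemma admissible_none {p : ℝ} (hp : ∀ v, I.P.real (I.event v) ≤ p) (hpd : p * 2 ^ d < 1) :
    I.Admissible d (fun _ => none) (fun _ _ => 1) where
  pos _ _ := one_pos
  add_eq_two _ _ := by norm_num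
  eq_one _ _ _ := rfl
  condProb_lt v := by
    rw [condProb_none]
    refine (hp v).trans_lt ?_
    rw [Finset.prod_const_one, mul_one, one_div, inv_pow, ← one_div, lt_div_iff₀ (by positivity)]
    exact hpd

/-- One more variable can be fixed. Only the weights of pairs of events that depend on it change;
these events are pairwise adjacent, so `exists_point_and_weights` applies to them. -/
lemma Admissible.exists_update [DecidableEq ι] (h : I.Admissible d a φ) {i : ι} (hi : i ∈ I.vars)
    (hai : a i = none) :
    ∃ (x : Val i) (ψ : Fin n → Fin n → ℝ), I.Admissible d (Function.update a i (some x)) ψ ∧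
      ∀ u v, ¬ (i ∈ I.vbl u ∧ i ∈ I.vbl v) → ψ u v = φ u v := by
  classical
  set ρ : Measure (Val i) := I.P.map (I.X ⟨i, hi⟩) with hρ
  have hρp : IsProbabilityMeasure ρ :=
    Measure.isProbabilityMeasure_map (I.measurable_X _).aemeasurable
  have hsplit : ∀ (ψ : Fin n → Fin n → ℝ) (u : Fin n), ∏ v, ψ u v =
      (∏ v : {v // ¬ i ∈ I.vbl v}, ψ u v) * ∏ v : {v // i ∈ I.vbl v}, ψ u v := fun ψ u => by
    rw [mul_comm, Fintype.prod_subtype_mul_prod_subtype]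
  obtain ⟨x, ψ, hψ0, hψ2, hψ⟩ := exists_point_and_weights (κ := {u // i ∈ I.vbl u}) ρ
    (φ := fun u v => φ u v) (fun u v => h.pos u v) (fun u v => h.add_eq_two u v)
    (R := fun u => (1 / 2) ^ d * ∏ v : {v // ¬ i ∈ I.vbl v}, φ u v)
    (fun u => mul_pos (by positivity) (Finset.prod_pos fun v _ => h.pos u v))
    (f := fun u x => (I.nodeInput u).condProb (Function.update a i (some x)))
    (fun u x => LLLNodeInput.condProb_nonneg)
    (fun u => LLLNodeInput.integrable_condProb_update (I.isProbabilityMeasure_law u)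
      (I.measurableSet_bad u) u.2 ρ)
    (fun u => by
      have h1 : ∫ x, (I.nodeInput u).condProb (Function.update a i (some x)) ∂ρ
          = (I.nodeInput u).condProb a := LLLNodeInput.integral_condProb_update
        (I.isProbabilityMeasure_law u) (I.measurableSet_bad u) (x := I.nodeInput u) u.2 hai
      rw [h1, mul_assoc, ← hsplit φ u]
      exact h.condProb_lt u)
  set ψ' : Fin n → Fin n → ℝ := fun u v =>
    if h : i ∈ I.vbl u ∧ i ∈ I.vbl v then ψ ⟨u, h.1⟩ ⟨v, h.2⟩ else φ u v with hψ'
  refine ⟨x, ψ', ⟨fun u v => ?_, fun u v => ?_, fun u v huv => ?_, fun u => ?_⟩,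
    fun u v huv => ?_⟩
  · simp only [hψ']
    split_ifs
    exacts [hψ0 _ _, h.pos _ _]
  · simp only [hψ', and_comm (a := i ∈ I.vbl v)]
    split_ifs
    exacts [hψ2 _ _, h.add_eq_two _ _]
  · simp only [hψ']
    split_ifs with hc
    · have : u = v := by
        by_contra hne
        exact huv ⟨hne, i, hc⟩
      subst this
      have := hψ2 ⟨u, hc.1⟩ ⟨u, hc.1⟩
      linarith
    · exact h.eq_one u v huv
  · by_cases hu : i ∈ I.vbl u
    · refine (hψ ⟨u, hu⟩).trans_eq ?_
      rw [hsplit ψ' u, mul_assoc]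
      congr 2
      · refine Finset.prod_congr rfl fun v _ => ?_
        simp [hψ', v.2]
      · refine Finset.prod_congr rfl fun v _ => ?_
        simp [hψ', v.2, hu]
    · have h1 : (I.nodeInput u).condProb (Function.update a i (some x)) =
          (I.nodeInput u).condProb a := by
        refine LLLNodeInput.condProb_congr fun j hj => Function.update_of_ne ?_ _ _
        rintro rfl
        exact hu hj
      rw [h1]
      refine (h.condProb_lt u).trans_eq ?_
      congr 1
      refine Finset.prod_congr rfl fun v _ => ?_
      simp [hψ', hu]
  · simp only [hψ']
    rw [dif_neg huv]

lemma Admissible.exists_extension (h : I.Admissible d a φ) (s : Finset ι) (hs : s ⊆ I.vars) :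
    ∃ (b : LLLNodeOutput Val) (ψ : Fin n → Fin n → ℝ), I.Admissible d b ψ ∧
      (∀ i ∈ s, (b i).isSome) ∧ (∀ i ∉ s, b i = a i) ∧ (∀ i, (a i).isSome → b i = a i) ∧
      ∀ u v, (∀ i ∈ s, ¬ (i ∈ I.vbl u ∧ i ∈ I.vbl v)) → ψ u v = φ u v := by
  classical
  induction s using Finset.induction_on with
  | empty => exact ⟨a, φ, h, by simp, by simp, by simp, by simp⟩
  | insert i s his ih =>
    obtain ⟨b, ψ, hb, hb1, hb2, hb3, hb4⟩ := ih ((Finset.subset_insert i s).trans hs)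
    rcases hbi : b i with _ | y
    · obtain ⟨x, χ, hχ, hχ1⟩ := hb.exists_update (hs (Finset.mem_insert_self i s)) hbi
      refine ⟨_, χ, hχ, fun j hj => ?_, fun j hj => ?_, fun j hj => ?_, fun u v huv => ?_⟩
      · rcases eq_or_ne j i with rfl | hji
        · simp
        · rw [Function.update_of_ne hji]
          exact hb1 j (Finset.mem_of_mem_insert_of_ne hj hji)
      · rw [Function.update_of_ne (fun e => hj (by rw [e]; exact Finset.mem_insert_self i s))]
        exact hb2 j fun h => hj (Finset.mem_insert_of_mem h)
      · rw [Function.update_of_ne, hb3 j hj]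
        rintro rfl
        rw [← hb3 j hj, hbi] at hj
        simp at hj
      · rw [hχ1 u v (huv i (Finset.mem_insert_self i s)),
          hb4 u v fun j hj => huv j (Finset.mem_insert_of_mem hj)]
    · refine ⟨b, ψ, hb, fun j hj => ?_, fun j hj => ?_, hb3, fun u v huv => ?_⟩
      · rcases eq_or_ne j i with rfl | hji
        · simp [hbi]
        · exact hb1 j (Finset.mem_of_mem_insert_of_ne hj hji)
      · exact hb2 j fun h => hj (Finset.mem_insert_of_mem h)
      · exact hb4 u v fun j hj => huv j (Finset.mem_insert_of_mem hj)

/-- The weights of an event of degree at most `d` have a product of at most `2 ^ d`. -/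
lemma Admissible.condProb_lt_one (h : I.Admissible d a φ) (v : Fin n)
    (hd : (I.dependencyGraph.neighborSet v).ncard ≤ d) : (I.nodeInput v).condProb a < 1 := by
  classical
  refine (h.condProb_lt v).trans_le ?_
  have h1 : ∏ u, φ v u ≤ ∏ u, if u ∈ I.dependencyGraph.neighborSet v then 2 else 1 := by
    refine Finset.prod_le_prod (fun u _ => (h.pos v u).le) fun u _ => ?_
    split_ifs with hu
    · linarith [h.add_eq_two v u, h.pos u v]
    · exact (h.eq_one v u hu).le
  rw [Finset.prod_ite, Finset.prod_const, Finset.prod_const_one, mul_one] at h1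
  have h2 : (Finset.univ.filter fun u => u ∈ I.dependencyGraph.neighborSet v).card ≤ d := by
    rwa [← Set.ncard_coe_finset, Finset.coe_filter_univ]
  calc (1 / 2 : ℝ) ^ d * ∏ u, φ v u ≤ (1 / 2) ^ d * 2 ^ d :=
        mul_le_mul_of_nonneg_left (h1.trans (pow_le_pow_right₀ one_le_two h2)) (by positivity)
    _ = 1 := by rw [← mul_pow]; norm_num

/-- If a partial assignment assigns a value to every variable of every event, and given it every
event has probability less than `1`, then it solves the instance. -/
lemma isSolution_of_condProb_lt_one {out : Fin n → LLLNodeOutput Val}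
    (hsome : ∀ v, ∀ i ∈ I.vbl v, (a i).isSome) (hlt : ∀ v, (I.nodeInput v).condProb a < 1)
    (hout : ∀ v, ∀ i ∈ I.vbl v, out v i = a i) : I.IsSolution out := by
  have : Nonempty I.Ω := nonempty_of_isProbabilityMeasure I.P
  refine ⟨fun i => (a i).getD (I.X i (Classical.arbitrary I.Ω)), fun v i => ?_, fun v => ?_⟩
  · obtain ⟨y, hy⟩ := Option.isSome_iff_exists.1 (hsome v i i.2)
    rw [hout v i i.2]
    simp [restrict, hy]
  · refine LLLNodeInput.notMem_bad_of_condProb_lt_one (x := I.nodeInput v) (a := a)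
      (I.measurableSet_bad v) _ (fun i => ?_) (hlt v)
    obtain ⟨y, hy⟩ := Option.isSome_iff_exists.1 (hsome v i i.2)
    simp [restrict, hy]

end LLLInstance

end CondProb

/-! ### The iterated logarithm -/

/-- Rounding up commutes with the binary logarithm rounded up, so that the iterated logarithm can
be computed with natural numbers. -/
lemma natClog_natCeil {x : ℝ} (hx : 1 < x) : Nat.clog 2 ⌈x⌉₊ = ⌈Real.logb 2 x⌉₊ := by
  refine eq_of_forall_ge_iff fun m => ?_
  rw [Nat.clog_le_iff_le_pow one_lt_two, Nat.ceil_le, Nat.ceil_le,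
    Real.logb_le_iff_le_rpow one_lt_two (by linarith)]
  norm_cast

lemma natClog_iterate_eq_natCeil {n k : ℕ} (h : ∀ j < k, 1 < (Real.logb 2)^[j] (n : ℝ)) :
    (Nat.clog 2)^[k] n = ⌈(Real.logb 2)^[k] (n : ℝ)⌉₊ := by
  induction k with
  | zero => simp
  | succ k ih =>
    rw [Function.iterate_succ_apply', Function.iterate_succ_apply',
      ih fun j hj => h j (hj.trans k.lt_succ_self), natClog_natCeil (h k k.lt_succ_self)]

lemma natClog_iterate_logStar_le_one (n : ℕ) : (Nat.clog 2)^[logStar n] n ≤ 1 := by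
  have hne : {k : ℕ | (Real.logb 2)^[k] (n : ℝ) ≤ 1}.Nonempty := by
    by_contra hc
    rw [Set.not_nonempty_iff_eq_empty, Set.eq_empty_iff_forall_notMem] at hc
    have hc : ∀ k, 1 < (Real.logb 2)^[k] (n : ℝ) := fun k => not_le.1 (hc k)
    have h1 : ∀ k, (Nat.clog 2)^[k] n = ⌈(Real.logb 2)^[k] (n : ℝ)⌉₊ := fun k =>
      natClog_iterate_eq_natCeil fun j _ => hc j
    have h2 : ∀ k, 1 < (Nat.clog 2)^[k] n := fun k => by
      rw [h1, Nat.lt_ceil]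
      exact_mod_cast hc k
    have h3 : ∀ k, (Nat.clog 2)^[k] n + k ≤ n := by
      intro k
      induction k with
      | zero => simp
      | succ k ih =>
        rw [Function.iterate_succ_apply']
        have h4 : Nat.clog 2 ((Nat.clog 2)^[k] n) ≤ (Nat.clog 2)^[k] n - 1 := by
          rw [Nat.clog_le_iff_le_pow one_lt_two]
          have := Nat.lt_two_pow_self (n := (Nat.clog 2)^[k] n - 1)
          omega
        have := h2 k
        omega
    have := h3 (n + 1)
    omega
  have hmem : (Real.logb 2)^[logStar n] (n : ℝ) ≤ 1 := Nat.sInf_mem hne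
  have hlt : ∀ j < logStar n, 1 < (Real.logb 2)^[j] (n : ℝ) := fun j hj =>
    not_le.1 (Nat.notMem_of_lt_sInf hj)
  rw [natClog_iterate_eq_natCeil hlt, Nat.ceil_le]
  exact_mod_cast hmem

lemma natClog_two_mul_le (x y : ℕ) : Nat.clog 2 (x * y) ≤ Nat.clog 2 x + Nat.clog 2 y := by
  rw [Nat.clog_le_iff_le_pow one_lt_two, pow_add]
  exact Nat.mul_le_mul (Nat.le_pow_clog one_lt_two x) (Nat.le_pow_clog one_lt_two y)

lemma natClog_two_add_le {x y : ℕ} (hx : 1 ≤ x) (hy : 1 ≤ y) :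
    Nat.clog 2 (x + y) ≤ 1 + (Nat.clog 2 x + Nat.clog 2 y) := by
  have h1 : x + y ≤ 2 * (x * y) := by nlinarith
  refine (Nat.clog_mono_right 2 h1).trans ((natClog_two_mul_le _ _).trans ?_)
  have := natClog_two_mul_le x y
  have h2 : Nat.clog 2 2 = 1 := by rw [Nat.clog_eq_one (le_refl 2) (le_refl 2)]
  omega

/-! ### Families of functions with few coincidences -/

/-- Functions on `{0, …, q - 1}` given by monic polynomials of degree `k + 1` over the field with
`q` elements. -/
lemma exists_function_family {q m k : ℕ} (hq : q.Prime) (hm : m ≤ q ^ (k + 1)) :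
    ∃ F : ℕ → ℕ → ℕ, (∀ c x, F c x < q) ∧
      (∀ c < m, ∀ c' < m, c ≠ c' →
        ((Finset.range q).filter fun x => F c x = F c' x).card ≤ k) ∧
      ∀ c b, ((Finset.range q).filter fun x => F c x = b).card ≤ k + 1 := by
  classical
  have : Fact q.Prime := ⟨hq⟩
  have : NeZero q := ⟨hq.ne_zero⟩
  obtain ⟨e⟩ : Nonempty (Fin m ↪ (Fin (k + 1) → ZMod q)) := by
    refine Function.Embedding.nonempty_of_card_le ?_
    simpa [ZMod.card] using hm
  set p : ℕ → Polynomial (ZMod q) := fun c => if h : c < m then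
    ((Polynomial.degreeLTEquiv (ZMod q) (k + 1)).symm (e ⟨c, h⟩) : Polynomial (ZMod q)) else 0
    with hp
  have hdeg : ∀ c, (p c).degree < (k + 1 : ℕ) := by
    intro c
    simp only [hp]
    split_ifs with h
    · exact Polynomial.mem_degreeLT.1 (Subtype.mem _)
    · rw [Polynomial.degree_zero]
      exact WithBot.bot_lt_coe _
  have hinj : ∀ c < m, ∀ c' < m, c ≠ c' → p c ≠ p c' := by
    intro c hc c' hc' hne heq
    simp only [hp, hc, hc', dif_pos] at heq
    have := e.injective ((Polynomial.degreeLTEquiv (ZMod q) (k + 1)).symm.injective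
      (Subtype.ext heq))
    exact hne (congrArg Fin.val this)
  -- a nonzero polynomial of degree at most `r` has at most `r` roots among `0, …, q - 1`
  have hroots : ∀ (P : Polynomial (ZMod q)) (r : ℕ), P ≠ 0 → P.natDegree ≤ r →
      ((Finset.range q).filter fun x : ℕ => P.eval (x : ZMod q) = 0).card ≤ r := by
    intro P r hP hr
    have h1 : ((Finset.range q).filter fun x : ℕ => P.eval (x : ZMod q) = 0).card ≤
        P.roots.toFinset.card := by
      refine Finset.card_le_card_of_injOn (fun x : ℕ => (x : ZMod q)) (fun x hx => ?_)
        (fun x hx y hy hxy => ?_)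
      · simpa [hP] using (Finset.mem_filter.1 hx).2
      · have h2 := Finset.mem_range.1 (Finset.mem_filter.1 hx).1
        have h3 := Finset.mem_range.1 (Finset.mem_filter.1 hy).1
        have h4 := congrArg ZMod.val hxy
        simpa [ZMod.val_cast_of_lt h2, ZMod.val_cast_of_lt h3] using h4
    exact h1.trans ((Multiset.toFinset_card_le _).trans ((Polynomial.card_roots' P).trans hr))
  refine ⟨fun c x => ((Polynomial.X ^ (k + 1) + p c).eval (x : ZMod q)).val,
    fun c x => ZMod.val_lt _, fun c hc c' hc' hne => ?_, fun c b => ?_⟩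
  · refine le_trans (Finset.card_le_card ?_) (hroots (p c - p c') k
      (sub_ne_zero.2 (hinj c hc c' hc' hne)) ?_)
    · intro x hx
      simp only [Finset.mem_filter] at hx ⊢
      refine ⟨hx.1, ?_⟩
      have := ZMod.val_injective q hx.2
      simp only [Polynomial.eval_add, add_right_inj] at this
      rw [Polynomial.eval_sub, this, sub_self]
    · have h1 : (p c - p c').degree < (k + 1 : ℕ) :=
        (Polynomial.degree_sub_le _ _).trans_lt (max_lt (hdeg c) (hdeg c'))
      have h2 := (Polynomial.natDegree_lt_iff_degree_lt
        (sub_ne_zero.2 (hinj c hc c' hc' hne))).2 h1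
      omega
  · have hmon : (Polynomial.X ^ (k + 1) + (p c - Polynomial.C (b : ZMod q))).Monic := by
      refine Polynomial.monic_X_pow_add ?_
      refine (Polynomial.degree_sub_le _ _).trans_lt (max_lt (hdeg c) ?_)
      refine Polynomial.degree_C_le.trans_lt ?_
      exact_mod_cast Nat.succ_pos k
    refine le_trans (Finset.card_le_card ?_) (hroots _ (k + 1) hmon.ne_zero ?_)
    · intro x hx
      simp only [Finset.mem_filter] at hx ⊢
      refine ⟨hx.1, ?_⟩
      have h1 := congrArg (Nat.cast : ℕ → ZMod q) hx.2
      rw [ZMod.natCast_zmod_val, Polynomial.eval_add] at h1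
      rw [Polynomial.eval_add, Polynomial.eval_sub, Polynomial.eval_C, ← h1]
      ring
    · refine (Polynomial.natDegree_add_le _ _).trans (max_le (Polynomial.natDegree_X_pow_le _) ?_)
      refine (Polynomial.natDegree_sub_le _ _).trans (max_le ?_ (by simp))
      exact (Polynomial.natDegree_le_iff_degree_le.2 (hdeg c).le)

/-! ### Distributed colour reduction -/

/-- The colours after `t` rounds in which every node replaces its colour by a function of the round,
of its colour, and of the set of the colours of its neighbours in `H`. -/
def colorRun {V : Type*} (H : SimpleGraph V) (f : ℕ → ℕ → Set ℕ → ℕ) (col : V → ℕ) : ℕ → V → ℕ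
  | 0 => col
  | t + 1 => fun v => f t (colorRun H f col t v) (colorRun H f col t '' H.neighborSet v)

/-- Proper colourings with the colours `0, …, m - 1`. -/
def IsProperColoring {V : Type*} (H : SimpleGraph V) (m : ℕ) (col : V → ℕ) : Prop :=
  (∀ v, col v < m) ∧ ∀ u v, H.Adj u v → col u ≠ col v

/-- There is a rule that in `T` rounds turns every proper colouring with `m` colours of every graph
on `V` of maximum degree at most `D` into one with `m'` colours. -/
def CanReduce (V : Type*) (D T m m' : ℕ) : Prop :=
  ∃ f : ℕ → ℕ → Set ℕ → ℕ, ∀ H : SimpleGraph V, (∀ v, (H.neighborSet v).ncard ≤ D) →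
    ∀ col, IsProperColoring H m col → IsProperColoring H m' (colorRun H f col T)

section Coloring

variable {V : Type*} {D : ℕ}

lemma CanReduce.refl {m m' : ℕ} (h : m ≤ m') : CanReduce V D 0 m m' :=
  ⟨fun _ c _ => c, fun _ _ _ hcol => ⟨fun v => (hcol.1 v).trans_le h, hcol.2⟩⟩

lemma CanReduce.trans {T S m m' m'' : ℕ} (h : CanReduce V D T m m') (h' : CanReduce V D S m' m'') :
    CanReduce V D (T + S) m m'' := by
  obtain ⟨f, hf⟩ := h
  obtain ⟨g, hg⟩ := h'
  refine ⟨fun t => if t < T then f t else g (t - T), fun H hH col hcol => ?_⟩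
  have h1 : ∀ t ≤ T, colorRun H (fun t => if t < T then f t else g (t - T)) col t =
      colorRun H f col t := by
    intro t ht
    induction t with
    | zero => rfl
    | succ t ih =>
      funext v
      simp only [colorRun, ih (Nat.le_of_succ_le ht), if_pos (Nat.lt_of_succ_le ht)]
  have h2 : ∀ s, colorRun H (fun t => if t < T then f t else g (t - T)) col (T + s) =
      colorRun H g (colorRun H f col T) s := by
    intro s
    induction s with
    | zero => exact h1 T le_rfl
    | succ s ih =>
      funext v
      rw [← Nat.add_assoc]
      simp only [colorRun, ih, if_neg (show ¬ T + s < T by omega), Nat.add_sub_cancel_left]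
  rw [h2]
  exact hg H hH _ (hf H hH col hcol)

lemma exists_forall_notMem_of_card_lt {N : Finset V} {q k : ℕ} (hN : k * N.card < q)
    (P : V → ℕ → Prop) [∀ u, DecidablePred (P u)]
    (hP : ∀ u ∈ N, ((Finset.range q).filter (P u)).card ≤ k) :
    ∃ x < q, ∀ u ∈ N, ¬ P u x := by
  classical
  by_contra! hc
  have h1 : Finset.range q ⊆ N.biUnion fun u => (Finset.range q).filter (P u) := by
    intro x hx
    obtain ⟨u, hu, hux⟩ := hc x (Finset.mem_range.1 hx)
    exact Finset.mem_biUnion.2 ⟨u, hu, Finset.mem_filter.2 ⟨hx, hux⟩⟩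
  have h2 := (Finset.card_le_card h1).trans (Finset.card_biUnion_le_card_mul _ _ k hP)
  rw [Finset.card_range, mul_comm] at h2
  omega

/-- Each node picks a point at which its function differs from the functions of its neighbours;
the point together with the value there is the new colour. -/
lemma canReduce_one [Finite V] {q m k : ℕ} (hq : q.Prime) (hm : m ≤ q ^ (k + 1))
    (hk : k * D < q) : CanReduce V D 1 m (q * q) := by
  classical
  obtain ⟨F, hF, hF1, -⟩ := exists_function_family hq hm
  have hpick : ∀ (c : ℕ) (S : Set ℕ), ∃ x, (∃ x < q, ∀ c' ∈ S, F c x ≠ F c' x) →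
      x < q ∧ ∀ c' ∈ S, F c x ≠ F c' x := by
    intro c S
    by_cases h : ∃ x < q, ∀ c' ∈ S, F c x ≠ F c' x
    · obtain ⟨x, hx⟩ := h
      exact ⟨x, fun _ => hx⟩
    · exact ⟨0, fun h' => absurd h' h⟩
  choose pick hpick using hpick
  refine ⟨fun _ c S => pick c S * q + F c (pick c S), fun H hH col hcol => ?_⟩
  have hex : ∀ v, ∃ x < q, ∀ c' ∈ col '' H.neighborSet v, F (col v) x ≠ F c' x := by
    intro v
    have hcard : (H.neighborSet v).toFinite.toFinset.card ≤ D := by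
      rw [← Set.ncard_eq_toFinset_card]
      exact hH v
    obtain ⟨x, hx, hx1⟩ := exists_forall_notMem_of_card_lt
      (N := (H.neighborSet v).toFinite.toFinset)
      ((Nat.mul_le_mul_left k hcard).trans_lt hk) (fun u x => F (col v) x = F (col u) x)
      (fun u hu => hF1 _ (hcol.1 v) _ (hcol.1 u) (hcol.2 v u (by simpa using hu)))
    refine ⟨x, hx, ?_⟩
    rintro _ ⟨u, hu, rfl⟩
    exact hx1 u (by simpa using hu)
  have hval : ∀ v, ∃ x < q, (∀ u, H.Adj v u → F (col v) x ≠ F (col u) x) ∧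
      colorRun H (fun _ c S => pick c S * q + F c (pick c S)) col 1 v = x * q + F (col v) x :=
    fun v => ⟨_, (hpick _ _ (hex v)).1, fun u hu => (hpick _ _ (hex v)).2 _ ⟨u, hu, rfl⟩, rfl⟩
  refine ⟨fun v => ?_, fun u v huv heq => ?_⟩
  · obtain ⟨x, hx, -, hxv⟩ := hval v
    rw [hxv]
    have := hF (col v) x
    nlinarith
  · obtain ⟨x, hx, hxn, hxu⟩ := hval u
    obtain ⟨y, hy, -, hyv⟩ := hval v
    rw [hxu, hyv] at heq
    have h1 := hF (col u) x
    have h2 := hF (col v) y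
    have h3 : x = y := by
      have hd := congrArg (· / q) heq
      simpa [Nat.add_div_of_dvd_right (Dvd.intro_left _ rfl), Nat.div_eq_of_lt h1,
        Nat.div_eq_of_lt h2, hq.pos] using hd
    subst h3
    exact hxn v huv (Nat.add_left_cancel heq)

/-- The reduction step in terms of the binary logarithm `L` of the number of colours, with
functions given by polynomials of degree about `L`. -/
lemma canReduce_one_pow_two [Finite V] (hD : 1 ≤ D) {L L' : ℕ} (hL : 1 ≤ L)
    (hL' : 2 + 2 * Nat.clog 2 D + 2 * Nat.clog 2 L ≤ L') :
    CanReduce V D 1 (2 ^ L) (2 ^ L') := by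
  obtain ⟨q, hq, hq1, hq2⟩ := Nat.exists_prime_lt_and_le_two_mul (L * D)
    (Nat.mul_pos hL hD).ne'
  have h1 : 2 ^ L ≤ q ^ (L + 1) :=
    (Nat.pow_le_pow_left hq.two_le L).trans (Nat.pow_le_pow_right hq.pos L.le_succ)
  have h2 : q ≤ 2 ^ (1 + Nat.clog 2 D + Nat.clog 2 L) := by
    rw [pow_add, pow_add, pow_one]
    calc q ≤ 2 * (L * D) := hq2
      _ = 2 * D * L := by ring
      _ ≤ _ := Nat.mul_le_mul (Nat.mul_le_mul_left 2 (Nat.le_pow_clog one_lt_two D))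
        (Nat.le_pow_clog one_lt_two L)
  refine (canReduce_one hq h1 hq1).trans (CanReduce.refl ?_)
  calc q * q ≤ 2 ^ (1 + Nat.clog 2 D + Nat.clog 2 L) * 2 ^ (1 + Nat.clog 2 D + Nat.clog 2 L) :=
        Nat.mul_le_mul h2 h2
    _ = 2 ^ (2 + 2 * Nat.clog 2 D + 2 * Nat.clog 2 L) := by rw [← pow_add]; congr 1; ring
    _ ≤ 2 ^ L' := Nat.pow_le_pow_right two_pos hL'

end Coloring

/-! ### Iterated colour reduction -/

section ColoringIteration

variable {V : Type*} {D : ℕ}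

/-- The recursion for the binary logarithm of the number of colours: up to an additive term of order
`log D` it is dominated by a multiple of the iterated logarithm. -/
lemma natClog_recursion_le (A g x a : ℕ) (hA : 2 ≤ A) (ha : a = Nat.clog 2 A) :
    2 + 2 * x + 2 * Nat.clog 2 (A * g + (4 * x + 2 ^ (a + 6))) ≤
      A * Nat.clog 2 g + (4 * x + 2 ^ (a + 6)) := by
  have hK : 64 * (a + 1) ≤ 2 ^ (a + 6) := by
    have : a + 1 ≤ 2 ^ a := Nat.lt_two_pow_self
    rw [pow_add]
    omega
  have hB : Nat.clog 2 (4 * x + 2 ^ (a + 6)) ≤ a + 6 + x := by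
    rw [Nat.clog_le_iff_le_pow one_lt_two, pow_add 2 (a + 6) x]
    have h1 : x + 1 ≤ 2 ^ x := Nat.lt_two_pow_self
    have h2 := Nat.mul_le_mul_left (2 ^ (a + 6)) h1
    have h3 : 4 * x ≤ 2 ^ (a + 6) * x := Nat.mul_le_mul_right x (by omega)
    have h4 : 2 ^ (a + 6) * (x + 1) = 2 ^ (a + 6) * x + 2 ^ (a + 6) := by ring
    omega
  have hg : Nat.clog 2 (A * g + (4 * x + 2 ^ (a + 6))) ≤ 2 * a + 7 + x + Nat.clog 2 g := by
    rcases Nat.eq_zero_or_pos g with rfl | hg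
    · simp only [mul_zero, zero_add]
      omega
    · have h1 := natClog_two_add_le (x := A * g) (y := 4 * x + 2 ^ (a + 6))
        (Nat.mul_pos (by omega) hg) (by omega)
      have h2 := natClog_two_mul_le A g
      omega
  have h5 := Nat.mul_le_mul_right (Nat.clog 2 g) hA
  omega

lemma canReduce_iterate [Finite V] (hD : 1 ≤ D) (n c t : ℕ) :
    CanReduce V D t (n ^ c + 1) (2 ^ ((c + 2) * (Nat.clog 2)^[t + 1] n +
      (4 * Nat.clog 2 D + 2 ^ (Nat.clog 2 (c + 2) + 6)))) := by
  induction t with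
  | zero =>
    refine CanReduce.refl ?_
    rw [zero_add, Function.iterate_one, pow_add]
    have h1 : n ^ c ≤ 2 ^ ((c + 2) * Nat.clog 2 n) := by
      calc n ^ c ≤ (2 ^ Nat.clog 2 n) ^ c := Nat.pow_le_pow_left (Nat.le_pow_clog one_lt_two n) c
        _ = 2 ^ (c * Nat.clog 2 n) := by rw [← pow_mul, mul_comm]
        _ ≤ _ := Nat.pow_le_pow_right two_pos (Nat.mul_le_mul_right _ (by omega))
    have h2 : 2 ≤ 2 ^ (4 * Nat.clog 2 D + 2 ^ (Nat.clog 2 (c + 2) + 6)) := by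
      have : 1 ≤ 2 ^ (Nat.clog 2 (c + 2) + 6) := Nat.one_le_two_pow
      exact (pow_one 2).symm.le.trans (Nat.pow_le_pow_right two_pos (by omega))
    have h3 : 1 ≤ 2 ^ ((c + 2) * Nat.clog 2 n) := Nat.one_le_two_pow
    nlinarith
  | succ t ih =>
    refine ih.trans (canReduce_one_pow_two hD ?_ ?_)
    · have : 1 ≤ 2 ^ (Nat.clog 2 (c + 2) + 6) := Nat.one_le_two_pow
      omega
    · rw [Function.iterate_succ_apply' _ (t + 1)]
      exact natClog_recursion_le _ _ _ _ (by omega) rfl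

lemma canReduce_logStar [Finite V] (hD : 1 ≤ D) (n c : ℕ) :
    CanReduce V D (logStar n) (n ^ c + 1)
      (2 ^ (4 * Nat.clog 2 D + 2 ^ (Nat.clog 2 (c + 2) + 6))) := by
  have h := canReduce_iterate (V := V) hD n c (logStar n)
  have h0 : (Nat.clog 2)^[logStar n + 1] n = 0 := by
    rw [Function.iterate_succ_apply']
    exact Nat.clog_of_right_le_one (natClog_iterate_logStar_le_one n) 2
  rwa [h0, mul_zero, zero_add] at h

/-- Reducing `m ≤ q ^ 4` colours to `q` colours in `q + 1` rounds. In round `s` a node with a colour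
`c < m` is at the position `F c s`, and if none of its neighbours is at the same position, then it
stops there for good, which is encoded by the new colour `m + F c s`. A node meets each of its
neighbours at most three times while both move, and at most four times after the neighbour has
stopped, and so at most `7 * D` times in all. -/
lemma canReduce_of_prime [Finite V] {q m : ℕ} (hq : q.Prime) (hm : m ≤ q ^ 4)
    (hk : 7 * D < q) : CanReduce V D (q + 1) m q := by
  classical
  obtain ⟨F, hF, hF1, hF2⟩ := exists_function_family (k := 3) hq hm
  set pos : ℕ → ℕ → ℕ := fun s c => if c < m then F c s else c - m with hpos
  set f : ℕ → ℕ → Set ℕ → ℕ := fun s c S =>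
    if m ≤ c ∨ ∃ c' ∈ S, pos s c' = pos s c then c else m + pos s c with hf
  suffices h : ∃ f : ℕ → ℕ → Set ℕ → ℕ, ∀ H : SimpleGraph V,
      (∀ v, (H.neighborSet v).ncard ≤ D) → ∀ col, IsProperColoring H m col →
      (∀ v, m ≤ colorRun H f col q v ∧ colorRun H f col q v < m + q) ∧
        ∀ u v, H.Adj u v → colorRun H f col q u ≠ colorRun H f col q v by
    obtain ⟨f, hf⟩ := h
    refine ⟨fun t => if t < q then f t else fun c _ => c - m, fun H hH col hcol => ?_⟩
    have h1 : ∀ t ≤ q, colorRun H (fun t => if t < q then f t else fun c _ => c - m) col t =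
        colorRun H f col t := by
      intro t ht
      induction t with
      | zero => rfl
      | succ t ih =>
        funext v
        simp only [colorRun, ih (Nat.le_of_succ_le ht), if_pos (Nat.lt_of_succ_le ht)]
    have h2 : ∀ v, colorRun H (fun t => if t < q then f t else fun c _ => c - m) col (q + 1) v =
        colorRun H f col q v - m := by
      intro v
      simp only [colorRun, h1 q le_rfl, lt_irrefl, if_false]
    obtain ⟨h3, h4⟩ := hf H hH col hcol
    refine ⟨fun v => ?_, fun u v huv => ?_⟩
    · rw [h2]
      have := h3 v
      omega
    · rw [h2, h2]
      have := h3 u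
      have := h3 v
      have := h4 u v huv
      omega
  refine ⟨f, fun H hH col hcol => ?_⟩
  set σ : ℕ → V → ℕ := colorRun H f col with hσ
  have hstep : ∀ t v, σ (t + 1) v = if m ≤ σ t v ∨ ∃ u, H.Adj v u ∧ pos t (σ t u) = pos t (σ t v)
      then σ t v else m + pos t (σ t v) := by
    intro t v
    simp only [hσ, colorRun, hf]
    congr 1
    simp
  have hposlt : ∀ t c, c < m + q → pos t c < q := by
    intro t c hc
    simp only [hpos]
    split_ifs
    · exact hF _ _
    · omega
  have hlt : ∀ t v, σ t v < m + q := by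
    intro t
    induction t with
    | zero => exact fun v => (hcol.1 v).trans_le (Nat.le_add_right _ _)
    | succ t ih =>
      intro v
      rw [hstep]
      split_ifs
      · exact ih v
      · exact Nat.add_lt_add_left (hposlt t _ (ih v)) m
  have hactive : ∀ t v, σ t v < m → σ t v = col v := by
    intro t
    induction t with
    | zero => exact fun v _ => rfl
    | succ t ih =>
      intro v hv
      rw [hstep] at hv ⊢
      split_ifs at hv ⊢ with h
      · exact ih v hv
      · omega
  have hfrozen : ∀ t s v, m ≤ σ t v → σ (t + s) v = σ t v := by
    intro t s v hv
    induction s with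
    | zero => rfl
    | succ s ih =>
      rw [← Nat.add_assoc, hstep, ih, if_pos (Or.inl hv)]
  have hproper : ∀ t u v, H.Adj u v → σ t u ≠ σ t v := by
    intro t
    induction t with
    | zero => exact hcol.2
    | succ t ih =>
      -- a node stops only at a position where no neighbour is in that round
      have hone : ∀ u v, H.Adj u v →
          ¬ (m ≤ σ t u ∨ ∃ x, H.Adj u x ∧ pos t (σ t x) = pos t (σ t u)) →
          m + pos t (σ t u) ≠ σ (t + 1) v := by
        intro u v huv hu heq
        rw [not_or, not_exists] at hu
        have hv := hu.2 v
        rw [not_and] at hv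
        have hv := hv huv
        rw [hstep] at heq
        split_ifs at heq with h
        · have hpv : pos t (σ t v) = pos t (σ t u) := by
            have : pos t (σ t v) = σ t v - m := by
              simp only [hpos]
              rw [if_neg (by omega)]
            omega
          exact hv hpv
        · exact hv (by omega)
      intro u v huv heq
      by_cases hu : m ≤ σ t u ∨ ∃ x, H.Adj u x ∧ pos t (σ t x) = pos t (σ t u)
      · by_cases hv : m ≤ σ t v ∨ ∃ x, H.Adj v x ∧ pos t (σ t x) = pos t (σ t v)
        · rw [hstep, hstep, if_pos hu, if_pos hv] at heq
          exact ih u v huv heq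
        · refine hone v u huv.symm hv ?_
          rw [heq, hstep, if_neg hv]
      · refine hone u v huv hu ?_
        rw [← heq, hstep, if_neg hu]
  refine ⟨fun v => ⟨?_, hlt q v⟩, hproper q⟩
  by_contra hv
  have hv : σ q v < m := not_le.1 hv
  have hvt : ∀ t ≤ q, σ t v < m := by
    intro t ht
    by_contra hc
    have h1 := hfrozen t (q - t) v (not_lt.1 hc)
    rw [Nat.add_sub_cancel' ht] at h1
    omega
  have hconf : ∀ t < q, ∃ u, H.Adj v u ∧ pos t (σ t u) = F (col v) t := by
    intro t ht
    by_contra hc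
    have h1 := hvt t ht.le
    have h2 := hvt (t + 1) ht
    have h3 : pos t (σ t v) = F (col v) t := by
      simp only [hpos]
      rw [if_pos h1, hactive t v h1]
    rw [hstep, h3, if_neg (fun h => h.elim (fun h => by omega) hc)] at h2
    omega
  have hcard : (H.neighborSet v).toFinite.toFinset.card ≤ D := by
    rw [← Set.ncard_eq_toFinset_card]
    exact hH v
  obtain ⟨t, ht, htu⟩ := exists_forall_notMem_of_card_lt
    (N := (H.neighborSet v).toFinite.toFinset) ((Nat.mul_le_mul_left 7 hcard).trans_lt hk)
    (fun u t => t < q ∧ pos t (σ t u) = F (col v) t) (fun u hu => by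
      have hadj : H.Adj v u := by simpa using hu
      have h1 := hF1 _ (hcol.1 v) _ (hcol.1 u) (hcol.2 v u hadj)
      have h2 := hF2 (col v) (σ q u - m)
      refine (Finset.card_le_card (t := ((Finset.range q).filter fun x => F (col v) x = F (col u) x)
        ∪ (Finset.range q).filter fun x => F (col v) x = σ q u - m) ?_).trans
        ((Finset.card_union_le _ _).trans (Nat.add_le_add h1 h2))
      intro t ht
      obtain ⟨ht, -, htu⟩ := Finset.mem_filter.1 ht
      rw [Finset.mem_union, Finset.mem_filter, Finset.mem_filter]
      by_cases hc : σ t u < m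
      · simp only [hactive t u hc, hpos, if_pos (hcol.1 u)] at htu
        exact Or.inl ⟨ht, htu.symm⟩
      · have h3 := hfrozen t (q - t) u (not_lt.1 hc)
        rw [Nat.add_sub_cancel' (Finset.mem_range.1 ht).le] at h3
        simp only [hpos, if_neg hc] at htu
        rw [h3]
        exact Or.inr ⟨ht, htu.symm⟩)
  obtain ⟨u, hu, hut⟩ := hconf t ht
  exact htu u (by simpa using hu) ⟨ht, hut⟩

/-- Colouring with `O(D)` colours in `O(D + log* n)` rounds, starting from distinct identifiers. -/
lemma exists_canReduce (c : ℕ) : ∃ C : ℕ, ∀ n D : ℕ, 1 ≤ D → ∃ T Q : ℕ,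
    T ≤ C * (D + logStar n) ∧ Q ≤ C * D ∧ CanReduce (Fin n) D T (n ^ c + 1) Q := by
  obtain ⟨K, hK⟩ : ∃ K, K = 2 ^ (Nat.clog 2 (c + 2) + 6) := ⟨_, rfl⟩
  refine ⟨2 * 2 ^ (K + 4) + 1, fun n D hD => ?_⟩
  have h0 : 0 < 2 ^ (K + 4) * D := Nat.mul_pos (by positivity) hD
  obtain ⟨q, hq, hq1, hq2⟩ := Nat.exists_prime_lt_and_le_two_mul (2 ^ (K + 4) * D) h0.ne'
  have h16 : 16 ≤ 2 ^ (K + 4) := by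
    rw [pow_add]
    have : 1 ≤ 2 ^ K := Nat.one_le_two_pow
    omega
  have h2D : 2 ^ Nat.clog 2 D ≤ 2 * D := by
    rcases hD.eq_or_lt with rfl | hD
    · simp
    · have h2 := Nat.pow_pred_clog_lt_self one_lt_two hD
      have h3 : 0 < Nat.clog 2 D := Nat.clog_pos one_lt_two hD
      obtain ⟨k, hk⟩ := Nat.exists_eq_succ_of_ne_zero h3.ne'
      rw [hk, Nat.pred_succ] at h2
      rw [hk, pow_succ]
      omega
  have hm : 2 ^ (4 * Nat.clog 2 D + K) ≤ q ^ 4 := by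
    calc 2 ^ (4 * Nat.clog 2 D + K) = (2 ^ Nat.clog 2 D) ^ 4 * 2 ^ K := by
          rw [pow_add, ← pow_mul, mul_comm 4]
      _ ≤ (2 * D) ^ 4 * (2 ^ (K + 3)) ^ 4 := by
          refine Nat.mul_le_mul (Nat.pow_le_pow_left h2D 4) ?_
          rw [← pow_mul]
          exact Nat.pow_le_pow_right two_pos (by omega)
      _ = (2 ^ (K + 4) * D) ^ 4 := by
          rw [← mul_pow]
          congr 1
          ring
      _ ≤ q ^ 4 := Nat.pow_le_pow_left hq1.le 4
  have hred := (canReduce_logStar (V := Fin n) hD n c).trans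
    (canReduce_of_prime hq (hK ▸ hm) (by nlinarith))
  generalize 2 ^ (K + 4) = Z at *
  refine ⟨logStar n + (q + 1), q, ?_, ?_, hred⟩
  · have h1 : (2 * Z + 1) * (D + logStar n) =
      2 * (Z * D) + D + (2 * (Z * logStar n) + logStar n) := by ring
    omega
  · have h1 : (2 * Z + 1) * D = 2 * (Z * D) + D := by ring
    omega

end ColoringIteration

/-! ### Two-hop dynamics in the LOCAL model -/

section TwoHop

/-- The nodes at distance at most `2` from `v`, including `v` itself. -/
def twoHopBall {V : Type*} (G : SimpleGraph V) (v : V) : Set V :=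
  {u | ∃ w, (w = v ∨ G.Adj v w) ∧ (u = w ∨ G.Adj w u)}

/-- The labels after `t` steps in which every node replaces its label by a function of the step, of
its label, and of the set of the labels in its two-hop ball. -/
def twoHopRun {V D : Type*} (G : SimpleGraph V) (F : ℕ → D → Set D → D) (lab : V → D) :
    ℕ → V → D
  | 0 => lab
  | t + 1 => fun v => F t (twoHopRun G F lab t v) (twoHopRun G F lab t '' twoHopBall G v)

/-- The state of a node that simulates two-hop dynamics with labels in `D`: the global parameters,
the number of simulated steps, its label and, in the second round of the simulation of a step,
the set of the labels of itself and of its neighbours. -/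
structure TwoHopState (D : Type u) : Type u where
  n : ℕ
  d : ℕ
  time : ℕ
  label : D
  heard : Option (Set D)

/-- The algorithm that broadcasts its whole state, simulates a step of two-hop dynamics in two
rounds, and stops after `T n d` steps with an output computed from the last label. -/
noncomputable def twoHopAlgorithm {In : Type u} {Out : Type w} {D : Type u}
    (init : ℕ → ℕ → ℕ → In → D) (F : ℕ → ℕ → ℕ → D → Set D → D) (T : ℕ → ℕ → ℕ)
    (O : ℕ → ℕ → D → Out) : LocalAlgorithm In Out where
  State := TwoHopState D
  Msg := TwoHopState D
  start n d ident _ inp := ⟨n, d, 0, init n d ident inp, none⟩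
  send s _ := s
  receive s L := match s.heard with
    | none => { s with heard := some (insert s.label (TwoHopState.label '' {m | some m ∈ L})) }
    | some S => { s with
        time := s.time + 1
        label := F s.n s.d s.time s.label
          (S ∪ {x | ∃ m, some m ∈ L ∧ ∃ S', m.heard = some S' ∧ x ∈ S'})
        heard := none }
  output s := match s.heard with
    | none => if s.time = T s.n s.d then some (O s.n s.d s.label) else none
    | some _ => none

variable {In : Type u} {Out : Type w} {D : Type u} (init : ℕ → ℕ → ℕ → In → D)
  (F : ℕ → ℕ → ℕ → D → Set D → D) (T : ℕ → ℕ → ℕ) (O : ℕ → ℕ → D → Out)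
  {V : Type*} {G : SimpleGraph V} (N : LocalNetwork G) (n d : ℕ)

lemma some_mem_ofFn_incoming {σ : V → TwoHopState D}
    (hσ : ∀ v, ¬ (twoHopAlgorithm init F T O).Terminated (σ v)) (v : V) (m : TwoHopState D) :
    some m ∈ List.ofFn ((twoHopAlgorithm init F T O).incoming N σ v) ↔
      ∃ u, G.Adj v u ∧ σ u = m := by
  have h1 : ∀ j, (twoHopAlgorithm init F T O).incoming N σ v j = some (σ (N.port v j)) := by
    intro j
    exact if_neg (hσ _)
  refine List.mem_ofFn.trans ⟨?_, ?_⟩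
  · rintro ⟨j, hj⟩
    exact ⟨N.port v j, (N.port v j).2, Option.some.inj ((h1 j).symm.trans hj)⟩
  · rintro ⟨u, hu, rfl⟩
    refine ⟨(N.port v).symm ⟨u, hu⟩, (h1 _).trans ?_⟩
    rw [Equiv.apply_symm_apply]

lemma step_twoHop_first {lab : V → D} {t : ℕ} (ht : t < T n d) :
    (twoHopAlgorithm init F T O).step N (fun v => ⟨n, d, t, lab v, none⟩) =
      fun v => ⟨n, d, t, lab v, some (lab '' {w | w = v ∨ G.Adj v w})⟩ := by
  have hσ : ∀ v : V, ¬ (twoHopAlgorithm init F T O).Terminated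
      ((fun v => ⟨n, d, t, lab v, none⟩ : V → TwoHopState D) v) := by
    rintro v ⟨o, ho⟩
    simp [twoHopAlgorithm, ht.ne] at ho
  funext v
  refine (if_neg (hσ v)).trans ?_
  change (⟨n, d, t, lab v, some _⟩ : TwoHopState D) = _
  congr 2
  ext x
  simp only [Set.mem_insert_iff, Set.mem_image, Set.mem_ofPred_eq]
  constructor
  · rintro (rfl | ⟨m, hm, rfl⟩)
    · exact ⟨v, Or.inl rfl, rfl⟩
    · obtain ⟨u, hu, rfl⟩ := (some_mem_ofFn_incoming init F T O N hσ v m).1 hm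
      exact ⟨u, Or.inr hu, rfl⟩
  · rintro ⟨u, rfl | hu, rfl⟩
    · exact Or.inl rfl
    · exact Or.inr ⟨_, (some_mem_ofFn_incoming init F T O N hσ v _).2 ⟨u, hu, rfl⟩, rfl⟩

lemma step_twoHop_second {lab : V → D} {t : ℕ} :
    (twoHopAlgorithm init F T O).step N
      (fun v => ⟨n, d, t, lab v, some (lab '' {w | w = v ∨ G.Adj v w})⟩) =
      fun v => ⟨n, d, t + 1, F n d t (lab v) (lab '' twoHopBall G v), none⟩ := by
  have hσ : ∀ v : V, ¬ (twoHopAlgorithm init F T O).Terminated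
      ((fun v => ⟨n, d, t, lab v, some (lab '' {w | w = v ∨ G.Adj v w})⟩ :
        V → TwoHopState D) v) := by
    rintro v ⟨o, ho⟩
    simp [twoHopAlgorithm] at ho
  funext v
  refine (if_neg (hσ v)).trans ?_
  change (⟨n, d, t + 1, F n d t (lab v) _, none⟩ : TwoHopState D) = _
  congr 2
  ext x
  simp only [Set.mem_union, Set.mem_image, Set.mem_ofPred_eq, twoHopBall]
  constructor
  · rintro (⟨u, hu, rfl⟩ | ⟨m, hm, S', hS', hx⟩)
    · exact ⟨u, ⟨v, Or.inl rfl, hu⟩, rfl⟩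
    · obtain ⟨w, hw, rfl⟩ := (some_mem_ofFn_incoming init F T O N hσ v m).1 hm
      obtain rfl := Option.some.inj hS'
      obtain ⟨u, hu, rfl⟩ := hx
      exact ⟨u, ⟨w, Or.inr hw, hu⟩, rfl⟩
  · rintro ⟨u, ⟨w, rfl | hw, hu⟩, rfl⟩
    · exact Or.inl ⟨u, hu, rfl⟩
    · exact Or.inr ⟨_, (some_mem_ofFn_incoming init F T O N hσ v _).2 ⟨w, hw, rfl⟩, _, rfl,
        ⟨u, hu, rfl⟩⟩

/-- Two-hop dynamics can be simulated in the LOCAL model with two rounds for each step. -/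
theorem twoHopAlgorithm_outputsWithin (inp : V → In) :
    (twoHopAlgorithm init F T O).OutputsWithin N n d inp (2 * T n d) fun v => O n d
      (twoHopRun G (F n d) (fun v => init n d (N.ident v) (inp v)) (T n d) v) := by
  have h : ∀ t ≤ T n d, (twoHopAlgorithm init F T O).run N n d inp (2 * t) = fun v =>
      (⟨n, d, t, twoHopRun G (F n d) (fun v => init n d (N.ident v) (inp v)) t v, none⟩ :
        TwoHopState D) := by
    intro t ht
    induction t with
    | zero => rfl
    | succ t ih =>
      have h1 := ih (Nat.le_of_succ_le ht)
      unfold LocalAlgorithm.run at h1 ⊢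
      rw [show 2 * (t + 1) = 2 * t + 1 + 1 by ring, Function.iterate_succ_apply',
        Function.iterate_succ_apply', h1]
      exact (congrArg _ (step_twoHop_first init F T O N n d (Nat.lt_of_succ_le ht))).trans
        (step_twoHop_second init F T O N n d)
  intro v
  rw [h _ le_rfl]
  simp [twoHopAlgorithm]

end TwoHop

/-! ### The distributed algorithm -/

section Algorithm

variable {ι : Type u} {Val : ι → Type w} [∀ i, MeasurableSpace (Val i)]

/-- The label of a node: its identifier, its input, its colour, values for some of the variables,
and its weights, indexed by the identifiers of the other nodes. -/
structure LLLLabel (Val : ι → Type w) [∀ i, MeasurableSpace (Val i)] where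
  ident : ℕ
  inp : LLLNodeInput Val
  color : ℕ
  asg : LLLNodeOutput Val
  wt : ℕ → ℝ

namespace LLLLabel

/-- Two labels share a variable. -/
def Shares (x y : LLLLabel Val) : Prop := ∃ i, i ∈ x.inp.vbl ∧ i ∈ y.inp.vbl

/-- Two labels belong to the same node or to adjacent nodes. -/
def Near (x y : LLLLabel Val) : Prop := x.ident = y.ident ∨ x.Shares y

open Classical in
/-- The values of the label `x`, overridden by `a` on the variables of the label `y`. -/
noncomputable def override (x y : LLLLabel Val) (a : LLLNodeOutput Val) : LLLNodeOutput Val :=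
  fun i => if i ∈ y.inp.vbl then a i else x.asg i

/-- New values `a` and weights `W` by which the node with the label `y`, in whose closed
neighbourhood the labels `S` occur, can fix all its variables: only weights of pairs of adjacent
nodes in this neighbourhood change, and the bounds on the probabilities of the events there are
preserved. All identifiers are less than `B`. -/
structure IsExtension (B d : ℕ) (y : LLLLabel Val) (S : Set (LLLLabel Val))
    (a : LLLNodeOutput Val) (W : ℕ → ℕ → ℝ) : Prop where
  isSome : ∀ i ∈ y.inp.vbl, (a i).isSome
  eq_asg : ∀ i ∈ y.inp.vbl, (y.asg i).isSome → a i = y.asg i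
  pos : ∀ x ∈ S, ∀ k, 0 < W x.ident k
  add_eq_two : ∀ x ∈ S, ∀ x' ∈ S, W x.ident x'.ident + W x'.ident x.ident = 2
  eq_wt : ∀ x ∈ S, ∀ k, (∀ x' ∈ S, x'.ident = k → ¬ x.Shares x') → W x.ident k = x.wt k
  condProb_lt : ∀ x ∈ S,
    x.inp.condProb (x.override y a) < (1 / 2) ^ d * ∏ k ∈ Finset.range B, W x.ident k

/-- The choice that the node with the label `y` makes. It depends only on `y` and on the set of
labels in its closed neighbourhood, so every node that knows these can reproduce it. -/
noncomputable def choice (B d : ℕ) (y : LLLLabel Val) (S : Set (LLLLabel Val)) :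
    LLLNodeOutput Val × (ℕ → ℕ → ℝ) :=
  Classical.epsilon fun q => IsExtension B d y S q.1 q.2

/-- The label of a node after the choice of the node with the label `y`, which is the node itself
or a neighbour of it. -/
noncomputable def update (B d : ℕ) (x y : LLLLabel Val) (S : Set (LLLLabel Val)) : LLLLabel Val :=
  { x with
    asg := x.override y (choice B d y S).1
    wt := (choice B d y S).2 x.ident }

open Classical in
/-- The step in which the nodes of colour `s` fix their variables, for a node with the label `x`
and the set `K` of labels in its two-hop ball. -/
noncomputable def act (B d s : ℕ) (x : LLLLabel Val) (K : Set (LLLLabel Val)) : LLLLabel Val :=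
  if h : ∃ y ∈ K, y.color = s ∧ y.Near x then
    x.update B d h.choose {x' ∈ K | h.choose.Near x'}
  else x

end LLLLabel

namespace LLLInstance

open LLLLabel

variable {n : ℕ} {I : LLLInstance.{u, w, z} Val n}

/-- The labels `lab` represent the colouring `col`, the partial assignment `a`, and the
weights `φ`. -/
structure Represents (N : LocalNetwork I.dependencyGraph) (lab : Fin n → LLLLabel Val)
    (col : Fin n → ℕ) (a : LLLNodeOutput Val) (φ : Fin n → Fin n → ℝ) : Prop where
  ident : ∀ v, (lab v).ident = N.ident v
  inp : ∀ v, (lab v).inp = I.nodeInput v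
  color : ∀ v, (lab v).color = col v
  asg : ∀ v, ∀ i ∈ I.vbl v, (lab v).asg i = a i
  wt : ∀ u v, (lab u).wt (N.ident v) = φ u v
  wt_eq_one : ∀ v, ∀ k ∉ Set.range N.ident, (lab v).wt k = 1

/-- The closed neighbourhood of a node in the dependency graph. -/
def closedNbhd (I : LLLInstance.{u, w, z} Val n) (v : Fin n) : Set (Fin n) :=
  {u | v = u ∨ I.dependencyGraph.Adj v u}

lemma mem_closedNbhd_comm {u v : Fin n} : u ∈ I.closedNbhd v ↔ v ∈ I.closedNbhd u := by
  simp only [closedNbhd, Set.mem_ofPred_eq, eq_comm (a := u), I.dependencyGraph.adj_comm u]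

lemma mem_closedNbhd_of_mem {u v : Fin n} {i : ι} (hu : i ∈ I.vbl u) (hv : i ∈ I.vbl v) :
    u ∈ I.closedNbhd v := by
  by_cases h : v = u
  · exact Or.inl h
  · exact Or.inr ⟨h, i, hv, hu⟩

lemma mem_twoHopBall_of_mem_closedNbhd {u v w : Fin n} (hu : w ∈ I.closedNbhd u)
    (hv : w ∈ I.closedNbhd v) : v ∈ twoHopBall I.dependencyGraph u :=
  ⟨w, hu.imp Eq.symm id, (mem_closedNbhd_comm.1 hv).imp Eq.symm id⟩

lemma prod_range_eq {N : LocalNetwork I.dependencyGraph} {B : ℕ} (hB : ∀ v, N.ident v < B)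
    {f : ℕ → ℝ} (hf : ∀ k ∉ Set.range N.ident, f k = 1) :
    ∏ k ∈ Finset.range B, f k = ∏ v, f (N.ident v) := by
  refine ((Finset.prod_map Finset.univ ⟨N.ident, N.ident_injective⟩ f).symm.trans ?_).symm
  refine Finset.prod_subset (fun k hk => ?_) fun k _ hk => hf k ?_
  · obtain ⟨v, -, rfl⟩ := Finset.mem_map.1 hk
    exact Finset.mem_range.2 (hB v)
  · rintro ⟨v, rfl⟩
    exact hk (Finset.mem_map_of_mem _ (Finset.mem_univ v))

variable {N : LocalNetwork I.dependencyGraph} {lab : Fin n → LLLLabel Val} {col : Fin n → ℕ}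
  {a : LLLNodeOutput Val} {φ : Fin n → Fin n → ℝ} {B d : ℕ}

namespace Represents

lemma shares_iff (h : I.Represents N lab col a φ) {u v : Fin n} :
    (lab u).Shares (lab v) ↔ ∃ i, i ∈ I.vbl u ∧ i ∈ I.vbl v := by
  unfold Shares
  rw [h.inp, h.inp]
  rfl

lemma near_iff (h : I.Represents N lab col a φ) {u v : Fin n} :
    (lab u).Near (lab v) ↔ v ∈ I.closedNbhd u := by
  unfold Near
  rw [h.shares_iff, h.ident, h.ident, N.ident_injective.eq_iff]
  constructor
  · rintro (h | ⟨i, hu, hv⟩)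
    exacts [Or.inl h, mem_closedNbhd_of_mem hv hu]
  · rintro (h | h)
    exacts [Or.inl h, Or.inr h.2]

/-- The choice that a node makes is constrained only through the labels in its closed
neighbourhood, and the values and weights that `Admissible.exists_extension` gives for the whole
graph satisfy these constraints. -/
lemma exists_isExtension (h : I.Represents N lab col a φ) (hφ : I.Admissible d a φ)
    (hB : ∀ v, N.ident v < B) (v : Fin n) :
    ∃ q : LLLNodeOutput Val × (ℕ → ℕ → ℝ),
      IsExtension B d (lab v) (lab '' I.closedNbhd v) q.1 q.2 := by
  obtain ⟨b, ψ, hψ, hb1, hb2, hb3, hb4⟩ := hφ.exists_extension (I.vbl v) (I.vbl_subset v)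
  set W : ℕ → ℕ → ℝ := fun k k' => Function.extend
    (fun q : Fin n × Fin n => (N.ident q.1, N.ident q.2)) (fun q => ψ q.1 q.2) (fun _ => 1)
    (k, k') with hW
  have hinj : Function.Injective (fun q : Fin n × Fin n => (N.ident q.1, N.ident q.2)) :=
    N.ident_injective.prodMap N.ident_injective
  have hW1 : ∀ u u', W (N.ident u) (N.ident u') = ψ u u' := fun u u' =>
    hinj.extend_apply _ _ (u, u')
  have hW2 : ∀ k, ∀ k' ∉ Set.range N.ident, W k k' = 1 := fun k k' hk =>
    Function.extend_apply' _ _ _ fun ⟨q, hq⟩ => hk ⟨q.2, congrArg Prod.snd hq⟩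
  refine ⟨(b, W), ⟨fun i hi => ?_, fun i hi hsome => ?_, ?_, ?_, ?_, ?_⟩⟩
  · rw [h.inp] at hi
    exact hb1 i hi
  · rw [h.inp] at hi
    rw [h.asg v i hi] at hsome ⊢
    exact hb3 i hsome
  · rintro _ ⟨u, hu, rfl⟩ k
    rw [h.ident]
    by_cases hk : k ∈ Set.range N.ident
    · obtain ⟨u', rfl⟩ := hk
      exact (hψ.pos u u').trans_eq (hW1 u u').symm
    · exact one_pos.trans_eq (hW2 _ k hk).symm
  · rintro _ ⟨u, hu, rfl⟩ _ ⟨u', hu', rfl⟩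
    rw [h.ident, h.ident]
    exact (congrArg₂ _ (hW1 u u') (hW1 u' u)).trans (hψ.add_eq_two u u')
  · rintro _ ⟨u, hu, rfl⟩ k hk
    rw [h.ident]
    by_cases hk' : k ∈ Set.range N.ident
    · obtain ⟨u', rfl⟩ := hk'
      rw [h.wt]
      refine (hW1 u u').trans (hb4 u u' fun i hi hc => ?_)
      exact hk _ ⟨u', mem_closedNbhd_of_mem hc.2 hi, rfl⟩ (h.ident u') (h.shares_iff.2 ⟨i, hc⟩)
    · rw [h.wt_eq_one u k hk']
      exact hW2 _ k hk'
  · rintro _ ⟨u, hu, rfl⟩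
    have h1 : (lab u).inp.condProb ((lab u).override (lab v) b) = (I.nodeInput u).condProb b := by
      rw [h.inp]
      refine LLLNodeInput.condProb_congr fun i hi => ?_
      unfold override
      rw [h.inp]
      split_ifs with hiv
      · rfl
      · rw [h.asg u i hi, hb2 i hiv]
    rw [h1, h.ident]
    have h2 : ∏ k ∈ Finset.range B, W (N.ident u) k = ∏ u', ψ u u' := by
      rw [prod_range_eq hB (hW2 _)]
      simp only [hW1]
    exact (hψ.condProb_lt u).trans_eq (congrArg _ h2.symm)

/-- A node near an acting node finds it, and its whole closed neighbourhood, in the two-hop ball. -/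
lemma act_eq_update (h : I.Represents N lab col a φ) {s : ℕ}
    (hs : ∀ u v, col u = s → col v = s → v ∈ twoHopBall I.dependencyGraph u → u = v)
    {v y : Fin n} (hy : col y = s) (hvy : v ∈ I.closedNbhd y) :
    (lab v).act B d s (lab '' twoHopBall I.dependencyGraph v) =
      (lab v).update B d (lab y) (lab '' I.closedNbhd y) := by
  have hex : ∃ x ∈ lab '' twoHopBall I.dependencyGraph v, x.color = s ∧ x.Near (lab v) :=
    ⟨lab y, ⟨y, mem_twoHopBall_of_mem_closedNbhd (Or.inl rfl) hvy, rfl⟩, by rw [h.color, hy],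
      h.near_iff.2 hvy⟩
  obtain ⟨⟨y', -, hy'⟩, hc1, hc2⟩ := hex.choose_spec
  rw [← hy', h.color] at hc1
  rw [← hy', h.near_iff] at hc2
  obtain rfl : y = y' := hs y y' hy hc1 (mem_twoHopBall_of_mem_closedNbhd hvy hc2)
  rw [act, dif_pos hex, ← hy']
  congr 1
  ext x
  constructor
  · rintro ⟨⟨u, -, rfl⟩, hu⟩
    exact ⟨u, h.near_iff.1 hu, rfl⟩
  · rintro ⟨u, hu, rfl⟩
    exact ⟨⟨u, ⟨y, (mem_closedNbhd_comm.1 hvy).imp Eq.symm id, hu.imp Eq.symm id⟩, rfl⟩,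
      h.near_iff.2 hu⟩

lemma act_eq_self (h : I.Represents N lab col a φ) {s : ℕ} {v : Fin n}
    (hv : ∀ y, col y = s → v ∉ I.closedNbhd y) (K : Set (Fin n)) :
    (lab v).act B d s (lab '' K) = lab v := by
  rw [act, dif_neg]
  rintro ⟨_, ⟨y, -, rfl⟩, hy1, hy2⟩
  rw [h.color] at hy1
  exact hv y hy1 (h.near_iff.1 hy2)

/-- If distinct nodes of the colour `s` have distance more than `2`, then the simultaneous choices
of these nodes preserve admissibility, and fix all their variables. -/
lemma exists_act (h : I.Represents N lab col a φ) (hφ : I.Admissible d a φ)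
    (hB : ∀ v, N.ident v < B) {s : ℕ}
    (hs : ∀ u v, col u = s → col v = s → v ∈ twoHopBall I.dependencyGraph u → u = v) :
    ∃ b ψ, I.Represents N
        (fun v => (lab v).act B d s (lab '' twoHopBall I.dependencyGraph v)) col b ψ ∧
      I.Admissible d b ψ ∧ (∀ i, (a i).isSome → (b i).isSome) ∧
      ∀ v, col v = s → ∀ i ∈ I.vbl v, (b i).isSome := by
  classical
  set lab' : Fin n → LLLLabel Val :=
    fun v => (lab v).act B d s (lab '' twoHopBall I.dependencyGraph v) with hlab'
  have hext : ∀ y, IsExtension B d (lab y) (lab '' I.closedNbhd y)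
      (choice B d (lab y) (lab '' I.closedNbhd y)).1
      (choice B d (lab y) (lab '' I.closedNbhd y)).2 := fun y =>
    Classical.epsilon_spec (h.exists_isExtension hφ hB y)
  have hact : ∀ v y, col y = s → v ∈ I.closedNbhd y →
      lab' v = (lab v).update B d (lab y) (lab '' I.closedNbhd y) := fun v y hy hvy =>
    h.act_eq_update hs hy hvy
  have hself : ∀ v, (∀ y, col y = s → v ∉ I.closedNbhd y) → lab' v = lab v := fun v hv =>
    h.act_eq_self hv _
  -- a variable belongs to at most one acting node, and a node is near at most one acting node
  have huniq : ∀ {y y' v}, col y = s → col y' = s → v ∈ I.closedNbhd y → v ∈ I.closedNbhd y' →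
      y = y' := fun hy hy' hv hv' => hs _ _ hy hy' (mem_twoHopBall_of_mem_closedNbhd hv hv')
  set b : LLLNodeOutput Val := fun i => if hi : ∃ y, col y = s ∧ i ∈ I.vbl y then
    (choice B d (lab hi.choose) (lab '' I.closedNbhd hi.choose)).1 i else a i with hb
  have hb1 : ∀ y, col y = s → ∀ i ∈ I.vbl y,
      b i = (choice B d (lab y) (lab '' I.closedNbhd y)).1 i := by
    intro y hy i hi
    have hex : ∃ y, col y = s ∧ i ∈ I.vbl y := ⟨y, hy, hi⟩
    simp only [hb]
    rw [dif_pos hex]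
    obtain ⟨h1, h2⟩ := hex.choose_spec
    rw [← huniq hy h1 (Or.inl rfl) (mem_closedNbhd_of_mem hi h2)]
  have hb2 : ∀ i, (¬ ∃ y, col y = s ∧ i ∈ I.vbl y) → b i = a i := fun i hi => dif_neg hi
  have hident : ∀ v, (lab' v).ident = N.ident v := by
    intro v
    by_cases hv : ∃ y, col y = s ∧ v ∈ I.closedNbhd y
    · obtain ⟨y, hy, hvy⟩ := hv
      rw [hact v y hy hvy]
      exact h.ident v
    · rw [hself v fun y hy hvy => hv ⟨y, hy, hvy⟩, h.ident]
  have hinp : ∀ v, (lab' v).inp = I.nodeInput v := by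
    intro v
    by_cases hv : ∃ y, col y = s ∧ v ∈ I.closedNbhd y
    · obtain ⟨y, hy, hvy⟩ := hv
      rw [hact v y hy hvy]
      exact h.inp v
    · rw [hself v fun y hy hvy => hv ⟨y, hy, hvy⟩, h.inp]
  have hcolor : ∀ v, (lab' v).color = col v := by
    intro v
    by_cases hv : ∃ y, col y = s ∧ v ∈ I.closedNbhd y
    · obtain ⟨y, hy, hvy⟩ := hv
      rw [hact v y hy hvy]
      exact h.color v
    · rw [hself v fun y hy hvy => hv ⟨y, hy, hvy⟩, h.color]
  have hasg : ∀ v, ∀ i ∈ I.vbl v, (lab' v).asg i = b i := by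
    intro v i hi
    by_cases hv : ∃ y, col y = s ∧ v ∈ I.closedNbhd y
    · obtain ⟨y, hy, hvy⟩ := hv
      rw [hact v y hy hvy]
      simp only [LLLLabel.update, override, h.inp]
      by_cases hiy : i ∈ I.vbl y
      · rw [hb1 y hy i hiy]
        exact if_pos hiy
      · rw [hb2 i, ← h.asg v i hi]
        · exact if_neg hiy
        · rintro ⟨y', hy', hiy'⟩
          obtain rfl := huniq hy hy' hvy (mem_closedNbhd_of_mem hi hiy')
          exact hiy hiy'
    · rw [hself v fun y hy hvy => hv ⟨y, hy, hvy⟩, h.asg v i hi, hb2]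
      rintro ⟨y, hy, hiy⟩
      exact hv ⟨y, hy, mem_closedNbhd_of_mem hi hiy⟩
  have hwt1 : ∀ v, ∀ k ∉ Set.range N.ident, (lab' v).wt k = 1 := by
    intro v k hk
    by_cases hv : ∃ y, col y = s ∧ v ∈ I.closedNbhd y
    · obtain ⟨y, hy, hvy⟩ := hv
      rw [hact v y hy hvy, ← h.wt_eq_one v k hk]
      refine (hext y).eq_wt _ ⟨v, hvy, rfl⟩ k ?_
      rintro _ ⟨u, -, rfl⟩ hu
      rw [h.ident] at hu
      exact absurd ⟨u, hu⟩ hk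
    · rw [hself v fun y hy hvy => hv ⟨y, hy, hvy⟩, h.wt_eq_one v k hk]
  set ψ : Fin n → Fin n → ℝ := fun u v => (lab' u).wt (N.ident v) with hψ
  have hψ1 : ∀ u v y, col y = s → u ∈ I.closedNbhd y →
      ψ u v = (choice B d (lab y) (lab '' I.closedNbhd y)).2 (lab u).ident (N.ident v) := by
    intro u v y hy hu
    simp only [hψ]
    rw [hact u y hy hu]
    rfl
  have hψ2 : ∀ u v, (∀ y, col y = s → u ∈ I.closedNbhd y → v ∈ I.closedNbhd y →
      ¬ ∃ i, i ∈ I.vbl u ∧ i ∈ I.vbl v) → ψ u v = φ u v := by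
    intro u v huv
    by_cases hu : ∃ y, col y = s ∧ u ∈ I.closedNbhd y
    · obtain ⟨y, hy, huy⟩ := hu
      rw [hψ1 u v y hy huy, ← h.wt u v]
      refine (hext y).eq_wt _ ⟨u, huy, rfl⟩ _ ?_
      rintro _ ⟨v', hv', rfl⟩ hv
      rw [h.ident] at hv
      obtain rfl := N.ident_injective hv
      rw [h.shares_iff]
      exact huv y hy huy hv'
    · simp only [hψ]
      rw [hself u fun y hy hvy => hu ⟨y, hy, hvy⟩, h.wt]
  have hψ3 : ∀ u v y, col y = s → u ∈ I.closedNbhd y → v ∈ I.closedNbhd y →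
      ψ u v + ψ v u = 2 := by
    intro u v y hy hu hv
    rw [hψ1 u v y hy hu, hψ1 v u y hy hv, ← h.ident u, ← h.ident v]
    exact (hext y).add_eq_two _ ⟨u, hu, rfl⟩ _ ⟨v, hv, rfl⟩
  have hsum : ∀ u v, ψ u v + ψ v u = 2 := by
    intro u v
    by_cases huv : ∃ y, col y = s ∧ u ∈ I.closedNbhd y ∧ v ∈ I.closedNbhd y
    · obtain ⟨y, hy, hu, hv⟩ := huv
      exact hψ3 u v y hy hu hv
    · rw [hψ2 u v fun y hy hu hv => absurd ⟨y, hy, hu, hv⟩ huv,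
        hψ2 v u fun y hy hv hu => absurd ⟨y, hy, hu, hv⟩ huv]
      exact hφ.add_eq_two u v
  refine ⟨b, ψ, ⟨hident, hinp, hcolor, hasg, fun _ _ => rfl, hwt1⟩,
    ⟨fun u v => ?_, hsum, fun u v huv => ?_, fun v => ?_⟩, fun i hi => ?_, fun v hv i hi => ?_⟩
  · by_cases hu : ∃ y, col y = s ∧ u ∈ I.closedNbhd y
    · obtain ⟨y, hy, huy⟩ := hu
      rw [hψ1 u v y hy huy]
      exact (hext y).pos _ ⟨u, huy, rfl⟩ _
    · simp only [hψ]
      rw [hself u fun y hy hvy => hu ⟨y, hy, hvy⟩, h.wt]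
      exact hφ.pos u v
  · rcases eq_or_ne u v with rfl | hne
    · linarith [hsum u u]
    · rw [hψ2 u v fun y _ _ _ hc => huv ⟨hne, hc⟩]
      exact hφ.eq_one u v huv
  · have h1 : (I.nodeInput v).condProb b = (I.nodeInput v).condProb (lab' v).asg :=
      LLLNodeInput.condProb_congr fun i hi => (hasg v i hi).symm
    have h2 : ∏ u, ψ v u = ∏ k ∈ Finset.range B, (lab' v).wt k :=
      (prod_range_eq hB (hwt1 v)).symm
    rw [h1, h2]
    by_cases hv : ∃ y, col y = s ∧ v ∈ I.closedNbhd y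
    · obtain ⟨y, hy, hvy⟩ := hv
      have h3 := (hext y).condProb_lt _ ⟨v, hvy, rfl⟩
      rw [h.inp] at h3
      rw [hact v y hy hvy]
      exact h3
    · rw [hself v fun y hy hvy => hv ⟨y, hy, hvy⟩, prod_range_eq hB (h.wt_eq_one v),
        LLLNodeInput.condProb_congr (x := I.nodeInput v) (h.asg v)]
      simp only [h.wt]
      exact hφ.condProb_lt v
  · by_cases hy : ∃ y, col y = s ∧ i ∈ I.vbl y
    · obtain ⟨y, hy, hiy⟩ := hy
      rw [hb1 y hy i hiy]
      exact (hext y).isSome i (by rw [h.inp]; exact hiy)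
    · rwa [hb2 i hy]
  · rw [hb1 v hv i hi]
    exact (hext v).isSome i (by rw [h.inp]; exact hi)

end Represents

end LLLInstance

end Algorithm

/-! ### Correctness of the algorithm -/

section Solution

/-- Two different nodes at distance at most `2` are adjacent in this graph. -/
def twoHopGraph {V : Type*} (G : SimpleGraph V) : SimpleGraph V where
  Adj u v := u ≠ v ∧ v ∈ twoHopBall G u
  symm := ⟨fun _ _ ⟨h, w, h1, h2⟩ => ⟨h.symm, w, h2.imp Eq.symm (fun h => G.adj_symm h),
    h1.imp Eq.symm (fun h => G.adj_symm h)⟩⟩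
  loopless := ⟨fun _ h => h.1 rfl⟩

lemma ncard_neighborSet_twoHopGraph_le {V : Type*} [Finite V] {G : SimpleGraph V} {d : ℕ}
    (hd : ∀ v, (G.neighborSet v).ncard ≤ d) (v : V) :
    ((twoHopGraph G).neighborSet v).ncard ≤ d + d * d := by
  classical
  have hcard : ∀ v, (G.neighborSet v).toFinite.toFinset.card ≤ d := fun v => by
    rw [← Set.ncard_eq_toFinset_card]
    exact hd v
  have hsub : (twoHopGraph G).neighborSet v ⊆
      ((G.neighborSet v).toFinite.toFinset ∪ (G.neighborSet v).toFinite.toFinset.biUnion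
        fun w => (G.neighborSet w).toFinite.toFinset : Finset V) := by
    rintro u ⟨hne, w, rfl | hw, rfl | hu⟩
    · exact absurd rfl hne
    · simp [hu]
    · simp [hw]
    · simp only [Finset.coe_union, Set.mem_union, Finset.mem_coe, Finset.mem_biUnion,
        Set.Finite.mem_toFinset, SimpleGraph.mem_neighborSet]
      exact Or.inr ⟨w, hw, hu⟩
  refine (Set.ncard_le_ncard hsub (Finset.finite_toSet _)).trans ?_
  rw [Set.ncard_coe_finset]
  refine (Finset.card_union_le _ _).trans (Nat.add_le_add (hcard v) ?_)
  exact (Finset.card_biUnion_le_card_mul _ _ d fun w _ => hcard w).trans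
    (Nat.mul_le_mul_right d (hcard v))

variable {ι : Type u} {Val : ι → Type w} [∀ i, MeasurableSpace (Val i)]

namespace LLLLabel

/-- The label of a node at the start: its colour is its identifier, no variable has a value, and all
weights are `1`. -/
def initial (ident : ℕ) (inp : LLLNodeInput Val) : LLLLabel Val where
  ident := ident
  inp := inp
  color := ident
  asg := fun _ => none
  wt := fun _ => 1

open Classical in
/-- The dynamics of the labels: for `T` steps the colouring rule `f` is applied, and after that the
nodes of the colour `s` act in step `T + s`. -/
noncomputable def rule (B d T : ℕ) (f : ℕ → ℕ → Set ℕ → ℕ) (t : ℕ) (x : LLLLabel Val)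
    (K : Set (LLLLabel Val)) : LLLLabel Val :=
  if t < T then { x with color := f t x.color (color '' {y ∈ K | x.ident ≠ y.ident}) }
  else x.act B d (t - T) K

/-- A valid assignment for a node none of whose variables belongs to another node. -/
noncomputable def soloChoice (x : LLLLabel Val) : LLLNodeOutput Val :=
  Classical.epsilon fun a => (∀ i ∈ x.inp.vbl, (a i).isSome) ∧ x.inp.condProb a < 1

end LLLLabel

namespace LLLInstance

open LLLLabel

variable {n : ℕ} {I : LLLInstance.{u, w, z} Val n} {N : LocalNetwork I.dependencyGraph}
  {B d T : ℕ} {f : ℕ → ℕ → Set ℕ → ℕ}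

lemma twoHopRun_coloring {t : ℕ} (ht : t ≤ T) :
    twoHopRun I.dependencyGraph (rule B d T f)
      (fun v => initial (N.ident v) (I.nodeInput v)) t = fun v =>
        { initial (N.ident v) (I.nodeInput v) with
          color := colorRun (twoHopGraph I.dependencyGraph) f N.ident t v } := by
  induction t with
  | zero => rfl
  | succ t ih =>
    funext v
    simp only [twoHopRun, colorRun, ih (Nat.le_of_succ_le ht), rule,
      if_pos (Nat.lt_of_succ_le ht)]
    congr 2
    ext k
    constructor
    · rintro ⟨_, ⟨⟨u, hu, rfl⟩, hne⟩, rfl⟩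
      exact ⟨u, ⟨fun h => hne (congrArg N.ident h), hu⟩, rfl⟩
    · rintro ⟨u, ⟨hne, hu⟩, rfl⟩
      exact ⟨_, ⟨⟨u, hu, rfl⟩, fun h => hne (N.ident_injective h)⟩, rfl⟩

/-- After the colour classes `0, …, s - 1` have acted, the weights are admissible and all the
variables of the events in these classes are fixed. -/
lemma exists_represents_twoHopRun (hB : ∀ v, N.ident v < B) {col : Fin n → ℕ}
    (hcol : col = colorRun (twoHopGraph I.dependencyGraph) f N.ident T)
    (hproper : ∀ u v, (twoHopGraph I.dependencyGraph).Adj u v → col u ≠ col v)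
    (h0 : I.Admissible d (fun _ => none) (fun _ _ => 1)) (s : ℕ) :
    ∃ a φ, I.Represents N (twoHopRun I.dependencyGraph (rule B d T f)
        (fun v => initial (N.ident v) (I.nodeInput v)) (T + s)) col a φ ∧
      I.Admissible d a φ ∧ ∀ v, col v < s → ∀ i ∈ I.vbl v, (a i).isSome := by
  induction s with
  | zero =>
    refine ⟨fun _ => none, fun _ _ => 1, ?_, h0, fun v hv => absurd hv (Nat.not_lt_zero _)⟩
    rw [Nat.add_zero, twoHopRun_coloring le_rfl, ← hcol]
    exact ⟨fun _ => rfl, fun _ => rfl, fun _ => rfl, fun _ _ _ => rfl, fun _ _ => rfl,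
      fun _ _ _ => rfl⟩
  | succ s ih =>
    obtain ⟨a, φ, h1, h2, h3⟩ := ih
    obtain ⟨b, ψ, h4, h5, h6, h7⟩ := h1.exists_act h2 hB (s := s) fun u v hu hv huv => by
      by_contra hne
      exact hproper u v ⟨hne, huv⟩ (hu.trans hv.symm)
    refine ⟨b, ψ, ?_, h5, fun v hv i hi => ?_⟩
    · rw [← Nat.add_assoc]
      simp only [twoHopRun, rule, if_neg (show ¬ T + s < T by omega), Nat.add_sub_cancel_left]
      exact h4
    · rcases Nat.lt_succ_iff_lt_or_eq.1 hv with hv | hv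
      · exact h6 i (h3 v hv i hi)
      · exact h7 v hv i hi

lemma isSolution_twoHopRun (hB : ∀ v, N.ident v < B)
    (hd : ∀ v, (I.dependencyGraph.neighborSet v).ncard ≤ d) {Q : ℕ}
    (hcol : IsProperColoring (twoHopGraph I.dependencyGraph) Q
      (colorRun (twoHopGraph I.dependencyGraph) f N.ident T))
    (h0 : I.Admissible d (fun _ => none) (fun _ _ => 1)) :
    I.IsSolution fun v => (twoHopRun I.dependencyGraph (rule B d T f)
        (fun v => initial (N.ident v) (I.nodeInput v)) (T + Q) v).asg := by
  obtain ⟨a, φ, h1, h2, h3⟩ := exists_represents_twoHopRun hB rfl hcol.2 h0 Q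
  exact isSolution_of_condProb_lt_one (fun v => h3 v (hcol.1 v))
    (fun v => h2.condProb_lt_one v (hd v)) h1.asg

/-- If no two events share a variable, then every node can choose its values on its own. -/
lemma isSolution_soloChoice (hd : ∀ v, (I.dependencyGraph.neighborSet v).ncard ≤ 0)
    (h0 : I.Admissible 0 (fun _ => none) (fun _ _ => 1)) :
    I.IsSolution fun v => (initial (N.ident v) (I.nodeInput v)).soloChoice := by
  classical
  set out : Fin n → LLLNodeOutput Val :=
    fun v => (initial (N.ident v) (I.nodeInput v)).soloChoice with hout
  have hspec : ∀ v, (∀ i ∈ I.vbl v, (out v i).isSome) ∧ (I.nodeInput v).condProb (out v) < 1 := by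
    intro v
    obtain ⟨b, ψ, hb, hb1, -⟩ := h0.exists_extension (I.vbl v) (I.vbl_subset v)
    exact Classical.epsilon_spec (p := fun a : LLLNodeOutput Val =>
      (∀ i ∈ I.vbl v, (a i).isSome) ∧ (I.nodeInput v).condProb a < 1)
      ⟨b, hb1, hb.condProb_lt_one v (hd v)⟩
  have huniq : ∀ u v i, i ∈ I.vbl u → i ∈ I.vbl v → u = v := by
    intro u v i hu hv
    by_contra hne
    have h1 : v ∈ I.dependencyGraph.neighborSet u := ⟨hne, i, hu, hv⟩
    have h2 := (Set.ncard_eq_zero (Set.toFinite _)).1 (Nat.le_zero.1 (hd u))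
    rw [h2] at h1
    exact h1
  set a : LLLNodeOutput Val := fun i => if h : ∃ v, i ∈ I.vbl v then out h.choose i else none
    with ha
  have ha1 : ∀ v, ∀ i ∈ I.vbl v, out v i = a i := by
    intro v i hi
    have hex : ∃ v, i ∈ I.vbl v := ⟨v, hi⟩
    simp only [ha]
    rw [dif_pos hex, ← huniq v _ i hi hex.choose_spec]
  refine isSolution_of_condProb_lt_one (a := a) (fun v i hi => ?_) (fun v => ?_) ha1
  · rw [← ha1 v i hi]
    exact (hspec v).1 i hi
  · rw [← LLLNodeInput.condProb_congr (x := I.nodeInput v) (ha1 v)]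
    exact (hspec v).2

end LLLInstance

end Solution

theorem mainTheorem2 (c : ℕ) :
    ∃ C : ℕ, ∀ (ι : Type u) (Val : ι → Type w) [∀ i, MeasurableSpace (Val i)],
      ∃ A : LocalAlgorithm (LLLNodeInput Val) (LLLNodeOutput Val),
        ∀ (n d : ℕ) (p : ℝ) (I : LLLInstance.{u, w, z} Val n)
          (N : LocalNetwork I.dependencyGraph),
          (∀ v, 1 ≤ N.ident v ∧ N.ident v ≤ n ^ c) →
          (∀ v, (I.dependencyGraph.neighborSet v).ncard ≤ d) →
          (∀ v, I.P.real (I.event v) ≤ p) →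
          p * 2 ^ d < 1 →
          ∃ T : ℕ, T ≤ C * (d ^ 2 + logStar n) ∧
            ∃ out : Fin n → LLLNodeOutput Val,
              A.OutputsWithin N n d I.nodeInput T out ∧ I.IsSolution out := by
  classical
  obtain ⟨C, hC⟩ := exists_canReduce c
  have hC' : ∀ n d : ℕ, ∃ (T Q : ℕ) (f : ℕ → ℕ → Set ℕ → ℕ), d ≠ 0 →
      T ≤ C * (d + d * d + logStar n) ∧ Q ≤ C * (d + d * d) ∧
      ∀ H : SimpleGraph (Fin n), (∀ v, (H.neighborSet v).ncard ≤ d + d * d) →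
        ∀ col, IsProperColoring H (n ^ c + 1) col → IsProperColoring H Q (colorRun H f col T) := by
    intro n d
    rcases eq_or_ne d 0 with rfl | hd
    · exact ⟨0, 0, fun _ k _ => k, fun h => absurd rfl h⟩
    · obtain ⟨T, Q, hT, hQ, f, hf⟩ := hC n (d + d * d) (by omega)
      exact ⟨T, Q, f, fun _ => ⟨hT, hQ, hf⟩⟩
  choose T Q f hf using hC'
  refine ⟨8 * C, fun ι Val _ => ⟨twoHopAlgorithm (fun _ _ ident inp => LLLLabel.initial ident inp)
    (fun n d => LLLLabel.rule (n ^ c + 1) d (T n d) (f n d))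
    (fun n d => if d = 0 then 0 else T n d + Q n d)
    (fun _ d x => if d = 0 then x.soloChoice else x.asg),
    fun n d p I N hN hd hp hpd => ⟨_, ?_, _, twoHopAlgorithm_outputsWithin _ _ _ _ N n d _, ?_⟩⟩⟩
  · rcases eq_or_ne d 0 with rfl | hd0
    · simp
    · obtain ⟨hT, hQ, -⟩ := hf n d hd0
      rw [if_neg hd0]
      have h1 : d ≤ d * d := Nat.le_mul_self d
      have h2 := Nat.mul_le_mul_left C h1
      have h3 : 8 * C * (d ^ 2 + logStar n) = 8 * (C * (d * d)) + 8 * (C * logStar n) := by ring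
      rw [mul_add, mul_add] at hT
      rw [mul_add] at hQ
      omega
  · have h0 := LLLInstance.admissible_none hp hpd
    rcases eq_or_ne d 0 with rfl | hd0
    · simpa only [if_true, twoHopRun] using LLLInstance.isSolution_soloChoice (N := N) hd h0
    · simp only [if_neg hd0]
      have hB : ∀ v, N.ident v < n ^ c + 1 := fun v => Nat.lt_succ_of_le (hN v).2
      exact LLLInstance.isSolution_twoHopRun hB hd ((hf n d hd0).2.2 _
        (ncard_neighborSet_twoHopGraph_le hd) _
        ⟨hB, fun u v huv h => huv.1 (N.ident_injective h)⟩) h0
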